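/- Let $d\ge 1$ be an integer. There exist constants $C_d,N_d>0$, depending only on $d$, such that the following holds. Let $f:\mathbb{R}^d\to[0,\infty)$ be a log-concave probability density (that is, $f(ax+by)\ge f(x)^a f(y)^b$ for all $x,y\in\mathbb{R}^d$ and $a,b\ge 0$ with $a+b=1$, and $\int_{\mathbb{R}^d} f=1$) which is centered, $\int_{\mathbb{R}^d} x f(x)\,dx=0$, and isotropic, i.e. its covariance matrix is $$\mathrm{Cov}(f)=\left(\int_{\mathbb{R}^d} x_ix_jf(x)\,dx\right)_{1\le i,j\le d}=\sigma^2 I_d$$ for some $\sigma>0$. Suppose $\sigma\ge N_d$. Then $\sum_{k\in\mathbb{Z}^d} f(k)>0$, the series $\sum_{k} f(k)$, $\sum_k k_i f(k)$, $\sum_k k_ik_jf(k)$ over $k\in\mathbb{Z}^d$ converge absolutely for all $1\le i,j\le d$, and the discrete covariance matrix $\mathrm{Cov}_{\mathbb{Z}^d}(f)$ with entries $$[\mathrm{Cov}_{\mathbb{Z}^d}(f)]_{ij}=\frac{\sum_{k\in\mathbb{Z}^d}k_ik_jf(k)}{\sum_{k\in\mathbb{Z}^d}f(k)}-\frac{\sum_{k\in\mathbb{Z}^d}k_if(k)\,\sum_{k\in\mathbb{Z}^d}k_jf(k)}{\bigl(\sum_{k\in\mathbb{Z}^d}f(k)\bigr)^2}$$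 satisfies $$\bigl|[\mathrm{Cov}_{\mathbb{Z}^d}(f)]_{ii}-\sigma^2\bigr|\le C_d\,\sigma\quad(1\le i\le d),\qquad \bigl|[\mathrm{Cov}_{\mathbb{Z}^d}(f)]_{ij}\bigr|\le C_d\,\sigma\quad(i\ne j),$$ and $$\Bigl|\det\bigl(\mathrm{Cov}_{\mathbb{Z}^d}(f)\bigr)-\sigma^{2d}\Bigr|\le C_d\,\sigma^{2d-1}.$$ That is, $\det(\mathrm{Cov}_{\mathbb{Z}^d}(f))=\sigma^{2d}+O_d(\sigma^{2d-1})$ as $\sigma\to\infty$, uniformly in $f$. -/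

import Mathlib

open MeasureTheory

noncomputable section

/-- `f = exp (-V)` with `V` convex and values of `V` in `ℝ ∪ {+∞}`: `f` is nonnegative and
`f (a x + b y) ≥ f x ^ a * f y ^ b` for all convex weights `a`, `b`. (At weight `0` the convention
`0 ^ 0 = 1` makes the inequality an equality.) -/
def IsLogConcave {d : ℕ} (f : (Fin d → ℝ) → ℝ) : Prop :=
  (∀ x, 0 ≤ f x) ∧
    ∀ (x y : Fin d → ℝ) (a b : ℝ), 0 ≤ a → 0 ≤ b → a + b = 1 →
      f x ^ a * f y ^ b ≤ f (a • x + b • y)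

/-- `f` is a probability density with respect to Lebesgue measure on `ℝ^d`. -/
def IsDensity {d : ℕ} (f : (Fin d → ℝ) → ℝ) : Prop :=
  (∀ x, 0 ≤ f x) ∧ Integrable f ∧ ∫ x, f x = 1

/-- The barycenter of `f` is the origin. -/
def IsCentered {d : ℕ} (f : (Fin d → ℝ) → ℝ) : Prop :=
  ∀ i, ∫ x, x i * f x = 0

/-- The (continuous) covariance matrix of `f` on `ℝ^d`. -/
def covR {d : ℕ} (f : (Fin d → ℝ) → ℝ) : Matrix (Fin d) (Fin d) ℝ :=
  Matrix.of fun i j =>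
    (∫ x, x i * x j * f x) / (∫ x, f x)
      - ((∫ x, x i * f x) * (∫ x, x j * f x)) / (∫ x, f x) ^ 2

/-- The restriction of a function on `ℝ^d` to the lattice `ℤ^d`. -/
def latticeRestrict {d : ℕ} (f : (Fin d → ℝ) → ℝ) : (Fin d → ℤ) → ℝ :=
  fun k => f fun i => (k i : ℝ)

/-- All series that enter the discrete covariance matrix of `p` converge absolutely, and the
normalizing sum is positive. -/
def HasCovZ {d : ℕ} (p : (Fin d → ℤ) → ℝ) : Prop :=
  Summable p ∧ (∀ i, Summable fun k : Fin d → ℤ => (k i : ℝ) * p k) ∧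
    (∀ i j, Summable fun k : Fin d → ℤ => (k i : ℝ) * (k j : ℝ) * p k) ∧ 0 < ∑' k, p k

/-- The discrete covariance matrix of `p` on `ℤ^d`. -/
def covZ {d : ℕ} (p : (Fin d → ℤ) → ℝ) : Matrix (Fin d) (Fin d) ℝ :=
  Matrix.of fun i j =>
    (∑' k : Fin d → ℤ, (k i : ℝ) * (k j : ℝ) * p k) / (∑' k, p k)
      - ((∑' k : Fin d → ℤ, (k i : ℝ) * p k) * (∑' k : Fin d → ℤ, (k j : ℝ) * p k))
        / (∑' k, p k) ^ 2

end

/-!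
The determinant of the row vectors of `W` measures volume: if every linear functional `u` satisfies
`u (W i) ^ 2 ≤ ∫ x, u (x - p) ^ 2 * f x`, then log-concavity places vectors comparable with the rows
of `W` in the superlevel set `{v | f p / e ≤ f (p + v)}`, whose volume is at most `e / f p`; hence
`f p * |det W|` is bounded in terms of `d`. For an isotropic density, `W = σ • 1` bounds the maximum
of `f` by a multiple of `σ ^ (-d)`, and replacing one row by `p` itself shows that `f` drops by a
factor `e` at distance of order `σ`. Log-concavity then gives
`f x ≤ A * (α / σ) ^ d * exp (-4 * (α / σ) * ‖x‖₁)`.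

On every line a quasiconcave function rises and then falls, so its variation is at most twice its
maximum. Applied to `√f`, this bounds the total oscillation of `f` over unit cubes, even with an
exponential weight, and so the lattice sums of `1`, `x i`, `x i * x j` against `f` differ from the
integrals by `O(1 / σ)`, `O(1)` and `O(σ)`. The covariance matrix is therefore `σ ^ 2 • 1` up to
`O(σ)`, and the Lipschitz bound for the determinant concludes.
-/

/-! ### Log-concave functions -/

theorem IsLogConcave.mul_le_sq {d : ℕ} {f : (Fin d → ℝ) → ℝ} (hf : IsLogConcave f)
    (x y : Fin d → ℝ) : f x * f y ≤ f ((2 : ℝ)⁻¹ • x + (2 : ℝ)⁻¹ • y) ^ 2 := by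
  have hmid := hf.2 x y 2⁻¹ 2⁻¹ (by norm_num) (by norm_num) (by norm_num)
  simp only [inv_eq_one_div (2 : ℝ), ← Real.sqrt_eq_rpow] at hmid ⊢
  rw [← Real.sqrt_mul (hf.1 x)] at hmid
  exact (Real.sqrt_le_left (hf.1 _)).1 hmid

theorem IsLogConcave.quasiconcaveOn {d : ℕ} {f : (Fin d → ℝ) → ℝ} (hf : IsLogConcave f) :
    QuasiconcaveOn ℝ Set.univ f := by
  refine quasiconcaveOn_iff_min_le.2 ⟨convex_univ, fun x _ y _ a b ha hb hab => ?_⟩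
  have hm : 0 ≤ min (f x) (f y) := le_min (hf.1 x) (hf.1 y)
  calc min (f x) (f y) = min (f x) (f y) ^ a * min (f x) (f y) ^ b := by
        rw [← Real.rpow_add_of_nonneg hm ha hb, hab, Real.rpow_one]
    _ ≤ f x ^ a * f y ^ b := mul_le_mul (Real.rpow_le_rpow hm (min_le_left _ _) ha)
        (Real.rpow_le_rpow hm (min_le_right _ _) hb) (Real.rpow_nonneg hm b)
        (Real.rpow_nonneg (hf.1 x) a)
    _ ≤ f (a • x + b • y) := hf.2 x y a b ha hb hab

theorem IsLogConcave.le_mul_exp_neg {d : ℕ} {f : (Fin d → ℝ) → ℝ} (hf : IsLogConcave f)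
    {p v : Fin d → ℝ} {t : ℝ} (ht : 1 ≤ t) (hp : 0 < f p)
    (hv : f (p + t⁻¹ • v) ≤ f p * Real.exp (-1)) : f (p + v) ≤ f p * Real.exp (-t) := by
  have ht₀ : 0 < t := by linarith
  have hsegment : f p ^ (1 - t⁻¹) * f (p + v) ^ t⁻¹ ≤ f p * Real.exp (-1) := by
    refine (hf.2 p (p + v) (1 - t⁻¹) t⁻¹ (sub_nonneg.2 (inv_le_one_of_one_le₀ ht))
      (inv_nonneg.2 ht₀.le) (by ring)).trans (le_trans (le_of_eq ?_) hv)
    congr 1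
    module
  have hsplit : f p * Real.exp (-1) = f p ^ (1 - t⁻¹) * (f p * Real.exp (-t)) ^ t⁻¹ := by
    rw [Real.mul_rpow hp.le (Real.exp_pos _).le, ← Real.exp_mul, ← mul_assoc, ← Real.rpow_add hp,
      sub_add_cancel, Real.rpow_one, neg_mul, mul_inv_cancel₀ ht₀.ne']
  rw [hsplit] at hsegment
  exact (Real.rpow_le_rpow_iff (hf.1 _) (by positivity) (inv_pos.2 ht₀)).1
    (le_of_mul_le_mul_left hsegment (Real.rpow_pos_of_pos hp _))

section SeminormDecay

variable {d : ℕ} {f : (Fin d → ℝ) → ℝ} (hf : IsLogConcave f) {N : Seminorm ℝ (Fin d → ℝ)}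
  {p : Fin d → ℝ} {a : ℝ} (ha : 0 < a) (hp : 0 < f p)
  (hN : ∀ v, N v = a → f (p + v) ≤ f p * Real.exp (-1))

include hf ha hp hN

theorem IsLogConcave.le_mul_exp_neg_seminorm {v : Fin d → ℝ} (hv : a ≤ N v) :
    f (p + v) ≤ f p * Real.exp (-(N v / a)) := by
  refine hf.le_mul_exp_neg ((one_le_div ha).2 hv) hp (hN _ ?_)
  have hNv : N v ≠ 0 := (ha.trans_le hv).ne'
  rw [map_smul_eq_mul, Real.norm_of_nonneg (by positivity), inv_div, div_mul_cancel₀ _ hNv]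

theorem IsLogConcave.sq_seminorm_mul_le (v : Fin d → ℝ) :
    N v ^ 2 * f (p + v) ≤ 4 * a ^ 2 * (f (p + v) + 2 * f (p + (2 : ℝ)⁻¹ • v)) := by
  have hfv := hf.1 (p + v)
  have hfw := hf.1 (p + (2 : ℝ)⁻¹ • v)
  rcases le_total (N v) (2 * a) with hv | hv
  · have hsq : N v ^ 2 ≤ 4 * a ^ 2 :=
      (pow_le_pow_left₀ (apply_nonneg N v) hv 2).trans_eq (by ring)
    calc N v ^ 2 * f (p + v) ≤ 4 * a ^ 2 * f (p + v) := mul_le_mul_of_nonneg_right hsq hfv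
      _ ≤ _ := mul_le_mul_of_nonneg_left (by linarith) (by positivity)
  have hhalf : N ((2 : ℝ)⁻¹ • v) = N v / 2 := by
    rw [map_smul_eq_mul, Real.norm_of_nonneg (by norm_num), inv_mul_eq_div]
  set t := N v / 2 / a with ht
  have hmidpoint : f p * f (p + v) ≤ f (p + (2 : ℝ)⁻¹ • v) ^ 2 := by
    convert hf.mul_le_sq p (p + v) using 3
    module
  have hdecay : f (p + (2 : ℝ)⁻¹ • v) ≤ f p * Real.exp (-t) := by
    have := hf.le_mul_exp_neg_seminorm ha hp hN (v := (2 : ℝ)⁻¹ • v) (by rw [hhalf]; linarith)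
    rwa [hhalf] at this
  have hcompare : f (p + v) ≤ f (p + (2 : ℝ)⁻¹ • v) * Real.exp (-t) := by
    refine le_of_mul_le_mul_left (hmidpoint.trans ?_) hp
    nlinarith [mul_le_mul_of_nonneg_left hdecay hfw]
  have hexp : t ^ 2 * Real.exp (-t) ≤ 2 := by
    have := Real.pow_div_factorial_le_exp t (by positivity) 2
    rw [Real.exp_neg, ← div_eq_mul_inv, div_le_iff₀ (Real.exp_pos t)]
    norm_num at this
    linarith
  calc N v ^ 2 * f (p + v) = 4 * a ^ 2 * (t ^ 2 * f (p + v)) := by rw [ht]; field_simp; norm_num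
    _ ≤ 4 * a ^ 2 * (t ^ 2 * (f (p + (2 : ℝ)⁻¹ • v) * Real.exp (-t))) := by gcongr
    _ = 4 * a ^ 2 * (t ^ 2 * Real.exp (-t) * f (p + (2 : ℝ)⁻¹ • v)) := by ring
    _ ≤ 4 * a ^ 2 * (2 * f (p + (2 : ℝ)⁻¹ • v)) := by gcongr
    _ ≤ _ := by gcongr; linarith

theorem IsLogConcave.integral_sq_seminorm_mul_le (hint : Integrable f) :
    ∫ x, N (x - p) ^ 2 * f x ≤ 4 * a ^ 2 * (1 + 2 * 2 ^ d) * ∫ x, f x := by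
  have hint_add : Integrable fun v => f (p + v) := hint.comp_add_left p
  have hint_half : Integrable fun v => f (p + (2 : ℝ)⁻¹ • v) :=
    hint_add.comp_smul (by norm_num : (2 : ℝ)⁻¹ ≠ 0)
  have hscale : ∫ v, f (p + (2 : ℝ)⁻¹ • v) = 2 ^ d * ∫ x, f x := by
    rw [Measure.integral_comp_smul volume (fun v => f (p + v)), integral_add_left_eq_self f p]
    simp
  calc ∫ x, N (x - p) ^ 2 * f x = ∫ v, N v ^ 2 * f (p + v) := by
        rw [← integral_add_left_eq_self (fun x => N (x - p) ^ 2 * f x) p]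
        simp only [add_sub_cancel_left]
    _ ≤ ∫ v, 4 * a ^ 2 * (f (p + v) + 2 * f (p + (2 : ℝ)⁻¹ • v)) :=
        integral_mono_of_nonneg
          (Filter.Eventually.of_forall fun v => mul_nonneg (sq_nonneg _) (hf.1 _))
          ((hint_add.add (hint_half.const_mul 2)).const_mul _)
          (Filter.Eventually.of_forall (hf.sq_seminorm_mul_le ha hp hN))
    _ = _ := by
        rw [integral_const_mul, integral_add hint_add (hint_half.const_mul 2), integral_const_mul,
          hscale, integral_add_left_eq_self f p]
        ring

end SeminormDecay

/-- Replacing the rows of `W` one at a time, each step multiplies the determinant by at least `c`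
because the determinant is a linear functional of the replaced row. -/
theorem exists_rows_mem_pow_mul_abs_det_le {ι : Type*} [Fintype ι] [DecidableEq ι]
    {K : Set (ι → ℝ)} {c : ℝ} (hc : 0 ≤ c) (W : Matrix ι ι ℝ)
    (hK : ∀ (u : (ι → ℝ) →ₗ[ℝ] ℝ) (i : ι), ∃ v ∈ K, c * |u (W i)| ≤ |u v|) :
    ∃ V : Matrix ι ι ℝ, (∀ i, V i ∈ K) ∧ c ^ Fintype.card ι * |W.det| ≤ |V.det| := by
  suffices ∀ s : Finset ι, ∃ V : Matrix ι ι ℝ, (∀ i ∈ s, V i ∈ K) ∧ (∀ i ∉ s, V i = W i) ∧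
      c ^ s.card * |W.det| ≤ |V.det| by
    obtain ⟨V, hV, -, hdet⟩ := this Finset.univ
    exact ⟨V, fun i => hV i (Finset.mem_univ i), hdet⟩
  intro s
  induction s using Finset.induction_on with
  | empty => exact ⟨W, by simp⟩
  | insert i s his ih =>
    obtain ⟨V, hVK, hVW, hdet⟩ := ih
    obtain ⟨v, hv, hdet_v⟩ := hK (Matrix.detRowAlternating.toMultilinearMap.toLinearMap V i) i
    change c * |(V.updateRow i (W i)).det| ≤ |(V.updateRow i v).det| at hdet_v
    rw [← hVW i his, V.updateRow_eq_self] at hdet_v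
    refine ⟨V.updateRow i v, fun j hj => ?_, fun j hj => ?_, ?_⟩
    · rcases eq_or_ne j i with rfl | hji
      · rwa [V.updateRow_self]
      · rw [V.updateRow_ne hji]
        exact hVK j (Finset.mem_of_mem_insert_of_ne hj hji)
    · rw [Finset.mem_insert, not_or] at hj
      rw [V.updateRow_ne hj.1, hVW j hj.2]
    · rw [Finset.card_insert_of_notMem his, pow_succ', mul_assoc]
      exact (mul_le_mul_of_nonneg_left hdet hc).trans hdet_v

theorem ofReal_abs_det_div_le_volume_of_convex {ι : Type*} [Fintype ι] [DecidableEq ι]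
    {K : Set (ι → ℝ)} (hK : Convex ℝ K) (h0 : 0 ∈ K) {V : Matrix ι ι ℝ} (hV : ∀ i, V i ∈ K) :
    ENNReal.ofReal (|V.det| / (Fintype.card ι : ℝ) ^ Fintype.card ι) ≤ volume K := by
  let Q : Set (ι → ℝ) := Set.Icc 0 fun _ => (Fintype.card ι : ℝ)⁻¹
  have hsub : Matrix.toLin' V.transpose '' Q ⊆ K := by
    rintro _ ⟨y, ⟨hy0, hy1⟩, rfl⟩
    have hsum : Matrix.toLin' V.transpose y = (1 - ∑ i, y i) • 0 + ∑ i, y i • V i := by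
      ext j
      simp [Matrix.mulVec, dotProduct, mul_comm]
    have hle : ∑ i, y i ≤ 1 := calc
      ∑ i, y i ≤ ∑ _i : ι, (Fintype.card ι : ℝ)⁻¹ := Finset.sum_le_sum fun i _ => hy1 i
      _ ≤ 1 := by simpa using mul_inv_le_one
    have hmem := hK.sum_mem (t := Finset.univ) (w := fun o : Option ι => o.elim (1 - ∑ i, y i) y)
      (z := fun o => o.elim 0 V) (by rintro (_ | i) -; exacts [sub_nonneg.2 hle, hy0 i])
      (by rw [Fintype.sum_option]; simp) (by rintro (_ | i) -; exacts [h0, hV i])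
    rw [Fintype.sum_option] at hmem
    rw [hsum]
    exact hmem
  refine le_trans (le_of_eq ?_) (measure_mono hsub)
  rw [Measure.addHaar_image_linearMap, Real.volume_Icc_pi, LinearMap.det_toLin',
    Matrix.det_transpose, div_eq_mul_inv, ENNReal.ofReal_mul (abs_nonneg _), ← inv_pow,
    ENNReal.ofReal_pow (by positivity)]
  simp

theorem mul_abs_det_div_le_integral {ι : Type*} [Fintype ι] [DecidableEq ι] {f : (ι → ℝ) → ℝ}
    (hf : QuasiconcaveOn ℝ Set.univ f) (hnonneg : ∀ x, 0 ≤ f x) (hint : Integrable f)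
    {ε : ℝ} (hε : 0 < ε) {p : ι → ℝ} (hp : ε ≤ f p) {V : Matrix ι ι ℝ}
    (hV : ∀ i, ε ≤ f (p + V i)) :
    ε * (|V.det| / (Fintype.card ι : ℝ) ^ Fintype.card ι) ≤ ∫ x, f x := by
  have hint_add : Integrable fun v => f (p + v) := hint.comp_add_left p
  have hconv : Convex ℝ {v | ε ≤ f (p + v)} := by
    simpa using (hf ε).translate_preimage_right p
  have hvol := ENNReal.ofReal_le_iff_le_toReal (hint_add.measure_ge_lt_top hε).ne |>.1
    (ofReal_abs_det_div_le_volume_of_convex hconv (by simpa using hp) hV)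
  calc _ ≤ ε * volume.real {v | ε ≤ f (p + v)} := mul_le_mul_of_nonneg_left hvol hε.le
    _ ≤ ∫ v, f (p + v) := mul_meas_ge_le_integral_of_nonneg
        (Filter.Eventually.of_forall fun v => hnonneg (p + v)) hint_add ε
    _ = ∫ x, f x := integral_add_left_eq_self f p

section DeterminantBound

variable {d : ℕ} {f : (Fin d → ℝ) → ℝ}

theorem IsLogConcave.exists_superlevel_linear_ge (hf : IsLogConcave f) (hdens : IsDensity f)
    (u : (Fin d → ℝ) →ₗ[ℝ] ℝ) {p w : Fin d → ℝ} (hp : 0 < f p)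
    (hw : u w ^ 2 ≤ ∫ x, u (x - p) ^ 2 * f x) :
    ∃ v ∈ {v | f p * Real.exp (-1) ≤ f (p + v)}, (4 * 2 ^ d : ℝ)⁻¹ * |u w| ≤ |u v| := by
  rcases eq_or_ne (u w) 0 with h0 | h0
  · exact ⟨0, by simpa using mul_le_of_le_one_right hp.le (Real.exp_le_one_iff.2 (by norm_num)),
      by simp [h0]⟩
  by_contra! hnarrow
  set a := (4 * 2 ^ d : ℝ)⁻¹ * |u w| with ha
  have hmoment : ∫ x, u (x - p) ^ 2 * f x ≤ 4 * a ^ 2 * (1 + 2 * 2 ^ d) := by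
    have := hf.integral_sq_seminorm_mul_le (N := u.toSeminorm) (a := a) (by positivity) hp
      (fun v hv => le_of_not_ge fun hge => (hnarrow v hge).ne hv) hdens.2.1
    simpa [hdens.2.2] using this
  have hsmall : 4 * ((4 * 2 ^ d : ℝ)⁻¹) ^ 2 * (1 + 2 * 2 ^ d) < 1 := by
    have : (1 : ℝ) ≤ 2 ^ d := one_le_pow₀ (by norm_num)
    rw [inv_pow, mul_right_comm, ← div_eq_mul_inv, div_lt_one (by positivity)]
    nlinarith
  have hself : u w ^ 2 ≤ 4 * ((4 * 2 ^ d : ℝ)⁻¹) ^ 2 * (1 + 2 * 2 ^ d) * u w ^ 2 := by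
    refine (hw.trans hmoment).trans_eq ?_
    rw [ha, mul_pow, sq_abs]
    ring
  nlinarith [sq_pos_of_ne_zero h0]

theorem IsLogConcave.mul_abs_det_le (hf : IsLogConcave f) (hdens : IsDensity f)
    (p : Fin d → ℝ) (W : Matrix (Fin d) (Fin d) ℝ)
    (hW : ∀ (u : (Fin d → ℝ) →ₗ[ℝ] ℝ) (i : Fin d), u (W i) ^ 2 ≤ ∫ x, u (x - p) ^ 2 * f x) :
    f p * |W.det| ≤ Real.exp 1 * (4 * 2 ^ d) ^ d * d ^ d := by
  rcases (hf.1 p).eq_or_lt with hp | hp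
  · rw [← hp, zero_mul]; positivity
  obtain ⟨V, hV, hdet⟩ := exists_rows_mem_pow_mul_abs_det_le (c := (4 * 2 ^ d : ℝ)⁻¹)
    (by positivity) W fun u i => hf.exists_superlevel_linear_ge hdens u hp (hW u i)
  have hmass := mul_abs_det_div_le_integral hf.quasiconcaveOn hf.1 hdens.2.1
    (ε := f p * Real.exp (-1)) (by positivity)
    (mul_le_of_le_one_right hp.le (Real.exp_le_one_iff.2 (by norm_num))) hV
  have hdd : (0 : ℝ) < d ^ d := by exact_mod_cast Nat.pow_self_pos
  rw [hdens.2.2, ← mul_div_assoc, Fintype.card_fin, div_le_one hdd] at hmass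
  rw [Fintype.card_fin, inv_pow, inv_mul_le_iff₀ (by positivity)] at hdet
  calc f p * |W.det| ≤ f p * ((4 * 2 ^ d) ^ d * |V.det|) := by gcongr
    _ = Real.exp 1 * (4 * 2 ^ d) ^ d * (f p * Real.exp (-1) * |V.det|) := by
        rw [Real.exp_neg]; field_simp
    _ ≤ _ := by gcongr

end DeterminantBound

/-! ### Isotropic densities -/

/-- The `ℓ¹` norm on `ι → ℝ`, whose own norm is the supremum norm; exponentials of `ℓ¹` norms
factor over the coordinates. -/
def l1Norm {ι : Type*} [Fintype ι] (x : ι → ℝ) : ℝ := ∑ i, |x i|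

theorem l1Norm_nonneg {ι : Type*} [Fintype ι] (x : ι → ℝ) : 0 ≤ l1Norm x :=
  Finset.sum_nonneg fun _ _ => abs_nonneg _

theorem l1Norm_le_card_mul_norm {ι : Type*} [Fintype ι] (x : ι → ℝ) :
    l1Norm x ≤ Fintype.card ι * ‖x‖ := by
  simpa [l1Norm] using Finset.sum_le_card_nsmul Finset.univ (fun i => |x i|) ‖x‖
    fun i _ => norm_le_pi_norm x i

/-- A centered probability density with covariance matrix `σ ^ 2 • 1`, `0 < σ`, all of whose
moments of order at most two converge. -/
structure IsIsotropicDensity {d : ℕ} (f : (Fin d → ℝ) → ℝ) (σ : ℝ) : Prop where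
  pos : 0 < σ
  isDensity : IsDensity f
  isCentered : IsCentered f
  integrable_coord : ∀ i, Integrable fun x : Fin d → ℝ => x i * f x
  integrable_coord_mul : ∀ i j, Integrable fun x : Fin d → ℝ => x i * x j * f x
  integral_coord_mul : ∀ i j,
    ∫ x : Fin d → ℝ, x i * x j * f x = (σ ^ 2 • (1 : Matrix (Fin d) (Fin d) ℝ)) i j

/-- The diagonal second moments converge because the junk value `0` of a divergent integral would
contradict `covR f i i = σ ^ 2`; they dominate all other moments. -/
theorem isIsotropicDensity_of_covR {d : ℕ} {f : (Fin d → ℝ) → ℝ} {σ : ℝ} (hdens : IsDensity f)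
    (hcent : IsCentered f) (hσ : 0 < σ)
    (hcov : covR f = σ ^ 2 • (1 : Matrix (Fin d) (Fin d) ℝ)) : IsIsotropicDensity f σ := by
  have hmoment : ∀ i j,
      ∫ x : Fin d → ℝ, x i * x j * f x = (σ ^ 2 • (1 : Matrix (Fin d) (Fin d) ℝ)) i j := by
    intro i j
    rw [← hcov]
    simp [covR, hdens.2.2, hcent i]
  have hsq : ∀ i, Integrable fun x : Fin d → ℝ => x i * x i * f x := by
    intro i
    by_contra hdiv
    have h := hmoment i i
    simp only [integral_undef hdiv, Matrix.smul_apply, Matrix.one_apply_eq, smul_eq_mul,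
      mul_one] at h
    exact (pow_pos hσ 2).ne h
  have hcoord : ∀ i, AEStronglyMeasurable (fun x : Fin d → ℝ => x i) volume := fun i =>
    (continuous_apply i).aestronglyMeasurable
  have hf := hdens.2.1.aestronglyMeasurable
  refine ⟨hσ, hdens, hcent, fun i => ?_, fun i j => ?_, hmoment⟩
  · refine (hdens.2.1.add (hsq i)).mono' ((hcoord i).mul hf)
      (Filter.Eventually.of_forall fun x => ?_)
    have hle : |x i| ≤ 1 + x i * x i := by
      nlinarith [abs_mul_abs_self (x i), sq_nonneg (|x i| - 1)]
    simpa [abs_mul, abs_of_nonneg (hdens.1 x), add_mul] using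
      mul_le_mul_of_nonneg_right hle (hdens.1 x)
  · refine ((hsq i).add (hsq j)).mono' (((hcoord i).mul (hcoord j)).mul hf)
      (Filter.Eventually.of_forall fun x => ?_)
    have hle : |x i * x j| ≤ x i * x i + x j * x j :=
      abs_le.2 ⟨by nlinarith [sq_nonneg (x i + x j)], by nlinarith [sq_nonneg (x i - x j)]⟩
    simpa [abs_mul, abs_of_nonneg (hdens.1 x), add_mul] using
      mul_le_mul_of_nonneg_right hle (hdens.1 x)

theorem linearMap_mul_eq_sum {ι : Type*} [Fintype ι] [DecidableEq ι]
    (u : (ι → ℝ) →ₗ[ℝ] ℝ) (x : ι → ℝ) (c : ℝ) :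
    u x * c = ∑ i, x i * c * u (Pi.single i 1) := by
  rw [u.pi_apply_eq_sum_univ x, Finset.sum_mul]
  refine Finset.sum_congr rfl fun i _ => ?_
  have hsingle : (fun j => if i = j then 1 else 0) = (Pi.single i 1 : ι → ℝ) := by
    ext j
    simp [Pi.single_apply, eq_comm]
  rw [hsingle, smul_eq_mul, mul_right_comm]

theorem linearMap_sq_mul_eq_sum {ι : Type*} [Fintype ι] [DecidableEq ι]
    (u : (ι → ℝ) →ₗ[ℝ] ℝ) (x : ι → ℝ) (c : ℝ) :
    u x ^ 2 * c = ∑ i, ∑ j, x i * x j * c * (u (Pi.single i 1) * u (Pi.single j 1)) := by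
  rw [sq, mul_assoc, linearMap_mul_eq_sum u x (u x * c)]
  refine Finset.sum_congr rfl fun i _ => ?_
  rw [mul_left_comm, linearMap_mul_eq_sum u x (x i * c), Finset.sum_mul]
  exact Finset.sum_congr rfl fun j _ => by ring

section Isotropic

variable {d : ℕ} {f : (Fin d → ℝ) → ℝ} {σ : ℝ}

theorem IsIsotropicDensity.integrable_linear (h : IsIsotropicDensity f σ)
    (u : (Fin d → ℝ) →ₗ[ℝ] ℝ) : Integrable fun x => u x * f x := by
  simp_rw [linearMap_mul_eq_sum u]
  exact integrable_finsetSum _ fun i _ => (h.integrable_coord i).mul_const _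

theorem IsIsotropicDensity.integral_linear (h : IsIsotropicDensity f σ)
    (u : (Fin d → ℝ) →ₗ[ℝ] ℝ) : ∫ x, u x * f x = 0 := by
  simp_rw [linearMap_mul_eq_sum u]
  rw [integral_finsetSum _ fun i _ => (h.integrable_coord i).mul_const _]
  simp [integral_mul_const, h.isCentered _]

theorem IsIsotropicDensity.integrable_sq_linear (h : IsIsotropicDensity f σ)
    (u : (Fin d → ℝ) →ₗ[ℝ] ℝ) : Integrable fun x => u x ^ 2 * f x := by
  simp_rw [linearMap_sq_mul_eq_sum u]
  exact integrable_finsetSum _ fun i _ => integrable_finsetSum _ fun j _ =>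
    (h.integrable_coord_mul i j).mul_const _

theorem IsIsotropicDensity.integral_sq_linear (h : IsIsotropicDensity f σ)
    (u : (Fin d → ℝ) →ₗ[ℝ] ℝ) :
    ∫ x, u x ^ 2 * f x = σ ^ 2 * ∑ i, u (Pi.single i 1) ^ 2 := by
  simp_rw [linearMap_sq_mul_eq_sum u]
  rw [integral_finsetSum _ fun i _ => integrable_finsetSum _ fun j _ =>
    (h.integrable_coord_mul i j).mul_const _, Finset.mul_sum]
  refine Finset.sum_congr rfl fun i _ => ?_
  rw [integral_finsetSum _ fun j _ => (h.integrable_coord_mul i j).mul_const _]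
  simp [integral_mul_const, h.integral_coord_mul, Matrix.one_apply, sq]

theorem IsIsotropicDensity.integral_sq_linear_sub (h : IsIsotropicDensity f σ)
    (u : (Fin d → ℝ) →ₗ[ℝ] ℝ) (p : Fin d → ℝ) :
    ∫ x, u (x - p) ^ 2 * f x = σ ^ 2 * ∑ i, u (Pi.single i 1) ^ 2 + u p ^ 2 := by
  have hexpand : ∀ x, u (x - p) ^ 2 * f x =
      u x ^ 2 * f x - 2 * u p * (u x * f x) + u p ^ 2 * f x := fun x => by rw [map_sub]; ring
  have hlin := (h.integrable_linear u).const_mul (2 * u p)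
  have hdiff : Integrable fun x => u x ^ 2 * f x - 2 * u p * (u x * f x) :=
    (h.integrable_sq_linear u).sub hlin
  simp_rw [hexpand]
  rw [integral_add hdiff (h.isDensity.2.1.const_mul _),
    integral_sub (h.integrable_sq_linear u) hlin, integral_const_mul, integral_const_mul,
    h.integral_linear, h.integral_sq_linear, h.isDensity.2.2]
  ring

theorem IsIsotropicDensity.sq_linear_le_integral (h : IsIsotropicDensity f σ)
    (u : (Fin d → ℝ) →ₗ[ℝ] ℝ) (p : Fin d → ℝ) :
    u p ^ 2 ≤ ∫ x, u (x - p) ^ 2 * f x := by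
  rw [h.integral_sq_linear_sub]
  exact le_add_of_nonneg_left (by positivity)

theorem IsIsotropicDensity.sq_linear_smul_one_le_integral (h : IsIsotropicDensity f σ)
    (u : (Fin d → ℝ) →ₗ[ℝ] ℝ) (p : Fin d → ℝ) (i : Fin d) :
    u ((σ • (1 : Matrix (Fin d) (Fin d) ℝ)) i) ^ 2 ≤ ∫ x, u (x - p) ^ 2 * f x := by
  have hrow : (σ • (1 : Matrix (Fin d) (Fin d) ℝ)) i = σ • Pi.single i 1 := by
    ext j
    simp [Matrix.one_apply, Pi.single_apply, eq_comm]
  rw [h.integral_sq_linear_sub, hrow, map_smul, smul_eq_mul, mul_pow]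
  refine le_add_of_le_of_nonneg (mul_le_mul_of_nonneg_left ?_ (sq_nonneg σ)) (sq_nonneg _)
  exact Finset.single_le_sum (f := fun j => u (Pi.single j 1) ^ 2) (fun _ _ => sq_nonneg _)
    (Finset.mem_univ i)

/-- A bound for the supremum of `σ ^ d * f`, uniform over centered isotropic log-concave densities
`f` on `ℝ ^ d`. -/
noncomputable def isotropicSupBound (d : ℕ) : ℝ := Real.exp 1 * (4 * 2 ^ d) ^ d * d ^ d

theorem isotropicSupBound_pos (d : ℕ) : 0 < isotropicSupBound d := by
  have hdd : (0 : ℝ) < d ^ d := by exact_mod_cast Nat.pow_self_pos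
  unfold isotropicSupBound
  positivity

theorem IsIsotropicDensity.mul_pow_le (h : IsIsotropicDensity f σ) (hf : IsLogConcave f)
    (x : Fin d → ℝ) : f x * σ ^ d ≤ isotropicSupBound d := by
  simpa [isotropicSupBound, abs_of_pos h.pos] using hf.mul_abs_det_le h.isDensity x (σ • 1)
    fun u i => h.sq_linear_smul_one_le_integral u x i

theorem IsIsotropicDensity.mul_pow_mul_abs_coord_le (h : IsIsotropicDensity f σ)
    (hf : IsLogConcave f) (x : Fin d → ℝ) (i : Fin d) :
    f x * σ ^ d * |x i| ≤ isotropicSupBound d * σ := by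
  have hrows := hf.mul_abs_det_le h.isDensity x
    ((σ • (1 : Matrix (Fin d) (Fin d) ℝ)).updateRow i x) fun u j => by
      rcases eq_or_ne j i with rfl | hj
      · rw [Matrix.updateRow_self]
        exact h.sq_linear_le_integral u x
      · rw [Matrix.updateRow_ne hj]
        exact h.sq_linear_smul_one_le_integral u x j
  have hdet : ((σ • (1 : Matrix (Fin d) (Fin d) ℝ)).updateRow i x).det = σ ^ (d - 1) * x i := by
    rw [← Matrix.cramer_transpose_apply, Matrix.transpose_smul, Matrix.transpose_one,
      Matrix.cramer_smul, Matrix.cramer_one]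
    simp
  rw [hdet, abs_mul, abs_of_pos (pow_pos h.pos _)] at hrows
  calc f x * σ ^ d * |x i| = f x * (σ ^ (d - 1) * |x i|) * σ := by
        rw [← pow_sub_one_mul i.pos.ne' σ]; ring
    _ ≤ _ := mul_le_mul_of_nonneg_right hrows h.pos.le

theorem IsIsotropicDensity.sq_mul_setIntegral_compl_closedBall_le (h : IsIsotropicDensity f σ)
    {r : ℝ} (hr : 0 ≤ r) : r ^ 2 * ∫ x in (Metric.closedBall 0 r)ᶜ, f x ≤ d * σ ^ 2 := by
  have hsum : Integrable fun x : Fin d → ℝ => ∑ i, x i * x i * f x :=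
    integrable_finsetSum _ fun i _ => h.integrable_coord_mul i i
  have hnonneg : ∀ (x : Fin d → ℝ) i, 0 ≤ x i * x i * f x := fun x i =>
    mul_nonneg (mul_self_nonneg _) (h.isDensity.1 x)
  have hpointwise : ∀ x ∈ (Metric.closedBall (0 : Fin d → ℝ) r)ᶜ,
      r ^ 2 * f x ≤ ∑ i, x i * x i * f x := by
    intro x hx
    have hx' : ¬ ‖x‖ ≤ r := by simpa using hx
    rw [pi_norm_le_iff_of_nonneg hr] at hx'
    push Not at hx'
    obtain ⟨i, hi⟩ := hx'
    refine le_trans ?_ (Finset.single_le_sum (fun i _ => hnonneg x i) (Finset.mem_univ i))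
    refine mul_le_mul_of_nonneg_right ?_ (h.isDensity.1 x)
    rw [← abs_mul_abs_self, ← sq]
    exact pow_le_pow_left₀ hr hi.le 2
  calc r ^ 2 * ∫ x in (Metric.closedBall 0 r)ᶜ, f x
      = ∫ x in (Metric.closedBall 0 r)ᶜ, r ^ 2 * f x := (integral_const_mul _ _).symm
    _ ≤ ∫ x in (Metric.closedBall 0 r)ᶜ, ∑ i, x i * x i * f x :=
        setIntegral_mono_on (h.isDensity.2.1.const_mul _).integrableOn hsum.integrableOn
          Metric.isClosed_closedBall.measurableSet.compl hpointwise
    _ ≤ ∫ x, ∑ i, x i * x i * f x := setIntegral_le_integral hsum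
        (Filter.Eventually.of_forall fun x => Finset.sum_nonneg fun i _ => hnonneg x i)
    _ = d * σ ^ 2 := by
        rw [integral_finsetSum _ fun i _ => h.integrable_coord_mul i i]
        simp [h.integral_coord_mul]

theorem IsIsotropicDensity.exists_norm_le_mul_pow_ge (h : IsIsotropicDensity f σ) :
    ∃ p : Fin d → ℝ, ‖p‖ ≤ (d + 1) * σ ∧ 1 / 2 ≤ f p * (2 * ((d + 1) * σ)) ^ d := by
  have hσ := h.pos
  set r := (d + 1) * σ with hr
  have hr0 : 0 < r := by positivity
  have hvol : volume (Metric.closedBall (0 : Fin d → ℝ) r) = ENNReal.ofReal ((2 * r) ^ d) := by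
    rw [Real.volume_pi_closedBall _ hr0.le, Fintype.card_fin]
  have htail : ∫ x in (Metric.closedBall 0 r)ᶜ, f x ≤ 1 / 2 := by
    have hcheb := h.sq_mul_setIntegral_compl_closedBall_le hr0.le
    refine le_of_mul_le_mul_left (hcheb.trans ?_) (pow_pos hr0 2)
    rw [hr, mul_pow]
    nlinarith [mul_nonneg (by positivity : (0 : ℝ) ≤ (d : ℝ) ^ 2 + 1) (sq_nonneg σ)]
  have hmass : 1 / 2 ≤ ∫ x in Metric.closedBall 0 r, f x := by
    have hball := (Metric.isClosed_closedBall (x := (0 : Fin d → ℝ)) (ε := r)).measurableSet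
    have htotal := integral_add_compl hball h.isDensity.2.1
    rw [h.isDensity.2.2] at htotal
    linarith
  obtain ⟨p, hp, havg⟩ := exists_setAverage_le
    (Metric.measure_closedBall_pos volume (0 : Fin d → ℝ) hr0).ne' measure_closedBall_lt_top.ne
    h.isDensity.2.1.integrableOn
  refine ⟨p, by simpa using hp, hmass.trans ?_⟩
  rwa [setAverage_eq, measureReal_def, hvol, ENNReal.toReal_ofReal (by positivity), smul_eq_mul,
    inv_mul_le_iff₀ (by positivity), mul_comm] at havg

theorem IsIsotropicDensity.le_mul_exp_neg_one_of_norm_ge (h : IsIsotropicDensity f σ)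
    (hf : IsLogConcave f) {R : ℝ} (hR : 0 < R) {p x : Fin d → ℝ}
    (hp : isotropicSupBound d * Real.exp 1 ≤ R * (f p * σ ^ d)) (hx : R * σ ≤ ‖x‖) :
    f x ≤ f p * Real.exp (-1) := by
  have hσ := h.pos
  obtain ⟨i, hi⟩ : ∃ i, R * σ ≤ |x i| := by
    by_contra! hlt
    exact hx.not_gt ((pi_norm_lt_iff (by positivity)).2 hlt)
  have hscaled : f x * σ ^ d * R ≤ isotropicSupBound d := by
    refine le_of_mul_le_mul_right ?_ hσ
    calc f x * σ ^ d * R * σ = f x * σ ^ d * (R * σ) := by ring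
      _ ≤ f x * σ ^ d * |x i| := mul_le_mul_of_nonneg_left hi (mul_nonneg (hf.1 x) (by positivity))
      _ ≤ _ := h.mul_pow_mul_abs_coord_le hf x i
  rw [Real.exp_neg, ← div_eq_mul_inv, le_div_iff₀ (Real.exp_pos 1)]
  refine le_of_mul_le_mul_left ?_ (mul_pos hR (pow_pos hσ d))
  nlinarith [mul_le_mul_of_nonneg_right hscaled (Real.exp_pos 1).le]

end Isotropic

theorem IsLogConcave.le_mul_exp_neg_norm {d : ℕ} {f : (Fin d → ℝ) → ℝ} (hf : IsLogConcave f)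
    {B r s : ℝ} (hB : ∀ x, f x ≤ B) (hr : 0 < r) (hs : 0 ≤ s) {p : Fin d → ℝ} (hp : ‖p‖ ≤ r)
    (hfp : 0 < f p) (hfar : ∀ x, s ≤ ‖x‖ → f x ≤ f p * Real.exp (-1)) (x : Fin d → ℝ) :
    f x ≤ B * Real.exp 2 * Real.exp (-(‖x‖ / (s + r))) := by
  have hρ : 0 < s + r := by positivity
  have hB0 : 0 ≤ B := hfp.le.trans (hB p)
  have hshift : f x ≤ B * Real.exp (1 - ‖x - p‖ / (s + r)) := by
    rcases le_total (s + r) ‖x - p‖ with hx | hx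
    · have hdecay := hf.le_mul_exp_neg_seminorm (N := normSeminorm ℝ (Fin d → ℝ)) hρ hfp
        (fun v hv => hfar _ (by
          rw [coe_normSeminorm] at hv
          linarith [norm_sub_le_norm_add v p, congrArg norm (add_comm v p)])) hx
      rw [add_sub_cancel, coe_normSeminorm] at hdecay
      exact hdecay.trans
        (mul_le_mul (hB p) (Real.exp_le_exp.2 (by linarith)) (Real.exp_pos _).le hB0)
    · refine (hB x).trans (le_mul_of_one_le_right hB0 (Real.one_le_exp ?_))
      linarith [(div_le_one hρ).2 hx]
  have hnorm : ‖x‖ / (s + r) ≤ ‖x - p‖ / (s + r) + 1 := by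
    rw [div_add_one hρ.ne']
    exact div_le_div_of_nonneg_right (by linarith [norm_le_norm_add_norm_sub' x p]) hρ.le
  refine hshift.trans ?_
  rw [mul_assoc, ← Real.exp_add]
  exact mul_le_mul_of_nonneg_left (Real.exp_le_exp.2 (by linarith)) hB0

theorem exists_isotropic_le_exp_neg_l1Norm (d : ℕ) :
    ∃ A α : ℝ, 0 < A ∧ 0 < α ∧ α ≤ 1 ∧ ∀ (f : (Fin d → ℝ) → ℝ) (σ : ℝ), IsLogConcave f →
      IsIsotropicDensity f σ → ∀ x,
        f x ≤ A * (α / σ) ^ d * Real.exp (-(4 * (α / σ) * l1Norm x)) := by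
  have hC := isotropicSupBound_pos d
  set R : ℝ := isotropicSupBound d * Real.exp 1 * (2 * (2 * (d + 1)) ^ d) with hR
  have hR0 : 0 < R := by positivity
  set α : ℝ := (4 * (d + 1) * (R + (d + 1)))⁻¹ with hα
  have hα0 : 0 < α := by positivity
  have hα1 : α ≤ 1 := inv_le_one_of_one_le₀ (by nlinarith)
  refine ⟨isotropicSupBound d * Real.exp 2 / α ^ d, α, by positivity, hα0, hα1, ?_⟩
  intro f σ hf h x
  have hσ := h.pos
  obtain ⟨p, hp, hfp⟩ := h.exists_norm_le_mul_pow_ge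
  have hfp' : isotropicSupBound d * Real.exp 1 ≤ R * (f p * σ ^ d) := by
    rw [← mul_assoc 2, mul_pow] at hfp
    rw [hR]
    nlinarith [mul_le_mul_of_nonneg_left hfp
      (by positivity : 0 ≤ 2 * (isotropicSupBound d * Real.exp 1))]
  have hfp0 : 0 < f p := by
    by_contra! hneg
    linarith [mul_nonpos_of_nonpos_of_nonneg hneg
      (by positivity : 0 ≤ (2 * ((d + 1) * σ)) ^ d)]
  have hdecay := hf.le_mul_exp_neg_norm
    (fun y => (le_div_iff₀ (pow_pos hσ d)).2 (h.mul_pow_le hf y)) (by positivity) (by positivity)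
    hp hfp0
    (fun z hz => h.le_mul_exp_neg_one_of_norm_ge hf hR0 hfp' hz) x
  have hrate : 4 * (α / σ) * l1Norm x ≤ ‖x‖ / (R * σ + (d + 1) * σ) := by
    have hl1 : l1Norm x ≤ (d + 1) * ‖x‖ := by
      have := l1Norm_le_card_mul_norm x
      rw [Fintype.card_fin] at this
      linarith [norm_nonneg x]
    calc 4 * (α / σ) * l1Norm x ≤ 4 * (α / σ) * ((d + 1) * ‖x‖) := by gcongr
      _ = ‖x‖ / (R * σ + (d + 1) * σ) := by rw [hα]; field_simp
  calc f x ≤ isotropicSupBound d / σ ^ d * Real.exp 2 *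
        Real.exp (-(‖x‖ / (R * σ + (d + 1) * σ))) := hdecay
    _ ≤ isotropicSupBound d / σ ^ d * Real.exp 2 * Real.exp (-(4 * (α / σ) * l1Norm x)) := by
        gcongr
    _ = _ := by rw [div_pow]; field_simp

/-! ### Lattice sums -/

theorem quasiconcaveOn_univ_comp_affineMap {E F : Type*} [AddCommGroup E] [Module ℝ E]
    [AddCommGroup F] [Module ℝ F] {f : F → ℝ} (hf : QuasiconcaveOn ℝ Set.univ f)
    (g : E →ᵃ[ℝ] F) : QuasiconcaveOn ℝ Set.univ (f ∘ g) := fun r => by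
  simpa using (hf r).affine_preimage g

theorem min_le_of_quasiconcaveOn {h : ℝ → ℝ} (hq : QuasiconcaveOn ℝ Set.univ h) {x y z : ℝ}
    (hxy : x ≤ y) (hyz : y ≤ z) : min (h x) (h z) ≤ h y :=
  ((hq (min (h x) (h z))).ordConnected.out ⟨trivial, min_le_left _ _⟩ ⟨trivial, min_le_right _ _⟩
    ⟨hxy, hyz⟩).2

section OneDimensional

variable {h : ℝ → ℝ} (hq : QuasiconcaveOn ℝ Set.univ h) (hnonneg : ∀ x, 0 ≤ h x) {t : ℝ}
  (ht : t ∈ Set.Icc 0 1)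

include hq hnonneg ht

/-- Beyond a point where `h` strictly decreases, `h` stays below the value it has dropped to, so
the successive drops telescope. -/
theorem sum_max_sub_le_of_quasiconcaveOn {B : ℝ} (hB : 0 ≤ B) {s : Finset ℤ}
    (hsB : ∀ k ∈ s, h k ≤ B) : ∑ k ∈ s, max (h k - h (k + t)) 0 ≤ B := by
  induction s using Finset.induction_on_min generalizing B with
  | empty => simpa using hB
  | insert a s ha ih =>
    rw [Finset.sum_insert fun h => lt_irrefl _ (ha a h)]
    rcases le_or_gt (h a) (h (a + t)) with hup | hdown
    · rw [max_eq_right (sub_nonpos.2 hup), zero_add]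
      exact ih hB fun k hk => hsB k (Finset.mem_insert_of_mem hk)
    have hafter : ∀ k ∈ s, h k ≤ h (a + t) := fun k hk => by
      have hak : (a : ℝ) + 1 ≤ k := by exact_mod_cast ha k hk
      exact (min_le_iff.1 (min_le_of_quasiconcaveOn hq (by linarith [ht.1])
        (by linarith [ht.2] : (a : ℝ) + t ≤ k))).resolve_left hdown.not_ge
    rw [max_eq_left (sub_nonneg.2 hdown.le)]
    linarith [ih (hnonneg _) hafter, hsB a (Finset.mem_insert_self _ _)]

theorem sum_abs_sub_le_of_quasiconcaveOn {B : ℝ} (hB : ∀ x, h x ≤ B) (s : Finset ℤ) :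
    ∑ k ∈ s, |h k - h (k + t)| ≤ 2 * B := by
  have hB0 : 0 ≤ B := (hnonneg 0).trans (hB 0)
  have hdrops : ∑ k ∈ s, max (h k - h (k + t)) 0 ≤ B :=
    sum_max_sub_le_of_quasiconcaveOn hq hnonneg ht hB0 fun k _ => hB k
  have hrises : ∑ k ∈ s, max (-(h k - h (k + t))) 0 ≤ B := by
    have hreflect := sum_max_sub_le_of_quasiconcaveOn (h := h ∘ AffineMap.lineMap t (t - 1))
      (quasiconcaveOn_univ_comp_affineMap hq _) (fun x => hnonneg _) ht hB0
      (s := s.map (Equiv.neg ℤ).toEmbedding) (fun k _ => hB _)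
    simpa [AffineMap.lineMap_apply, add_comm, sub_eq_add_neg] using hreflect
  calc ∑ k ∈ s, |h k - h (k + t)|
      = ∑ k ∈ s, max (h k - h (k + t)) 0 + ∑ k ∈ s, max (-(h k - h (k + t))) 0 := by
        rw [← Finset.sum_add_distrib]
        simp only [max_zero_add_max_neg_zero_eq_abs_self]
    _ ≤ 2 * B := by linarith

end OneDimensional

theorem sum_exp_neg_abs_le {s : ℝ} (hs : 0 < s) (T : Finset ℤ) :
    ∑ k ∈ T, Real.exp (-(s * |(k : ℝ)|)) ≤ 2 + 2 / s := by
  set r := Real.exp (-s) with hr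
  have hr1 : r ≤ 1 / (1 + s) := by
    rw [hr, Real.exp_neg, ← one_div]
    exact one_div_le_one_div_of_le (by positivity) (by linarith [Real.add_one_le_exp s])
  have hlt : r < 1 := Real.exp_lt_one_iff.2 (by linarith)
  have hgeom := hasSum_geometric_of_lt_one (Real.exp_pos _).le hlt
  have hpow : ∀ n : ℕ, Real.exp (-(s * n)) = r ^ n := fun n => by
    rw [hr, ← Real.exp_nat_mul]
    ring_nf
  have hnonneg_half : HasSum (fun n : ℕ => Real.exp (-(s * |((n : ℤ) : ℝ)|))) (1 - r)⁻¹ := by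
    simpa [hpow] using hgeom
  have hneg_half : HasSum (fun n : ℕ => Real.exp (-(s * |((-((n : ℤ) + 1) : ℤ) : ℝ)|)))
      (r * (1 - r)⁻¹) := by
    have hcast : ∀ n : ℕ, |((-((n : ℤ) + 1) : ℤ) : ℝ)| = ((n + 1 : ℕ) : ℝ) := fun n => by
      rw [Int.cast_neg, abs_neg]
      push_cast
      exact abs_of_nonneg (by positivity)
    simp_rw [hcast, hpow, pow_succ']
    exact hgeom.mul_left r
  refine (sum_le_hasSum T (fun k _ => (Real.exp_pos _).le)
    (HasSum.of_nat_of_neg_add_one (f := fun k : ℤ => Real.exp (-(s * |(k : ℝ)|)))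
      hnonneg_half hneg_half)).trans ?_
  have hgap : s / (1 + s) ≤ 1 - r := by
    have : s / (1 + s) = 1 - 1 / (1 + s) := by field_simp; ring
    linarith
  calc (1 - r)⁻¹ + r * (1 - r)⁻¹ = (1 + r) / (1 - r) := by ring
    _ ≤ 2 / (s / (1 + s)) := div_le_div₀ (by norm_num) (by linarith) (by positivity) hgap
    _ = 2 + 2 / s := by field_simp; ring

/-- The embedding of the lattice `ι → ℤ` into `ι → ℝ`. -/
def latticePoint {ι : Type*} (k : ι → ℤ) : ι → ℝ := fun i => k i

theorem sum_exp_neg_l1Norm_le {ι : Type*} [Fintype ι] {s : ℝ} (hs : 0 < s)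
    (S : Finset (ι → ℤ)) :
    ∑ k ∈ S, Real.exp (-(s * l1Norm (latticePoint k))) ≤ (2 + 2 / s) ^ Fintype.card ι := by
  classical
  let T : ι → Finset ℤ := fun i => S.image fun k => k i
  have hST : S ⊆ Fintype.piFinset T := fun k hk =>
    Fintype.mem_piFinset.2 fun i => Finset.mem_image_of_mem (fun k => k i) hk
  calc ∑ k ∈ S, Real.exp (-(s * l1Norm (latticePoint k)))
      ≤ ∑ k ∈ Fintype.piFinset T, Real.exp (-(s * l1Norm (latticePoint k))) :=
        Finset.sum_le_sum_of_subset_of_nonneg hST fun _ _ _ => (Real.exp_pos _).le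
    _ = ∑ k ∈ Fintype.piFinset T, ∏ i, Real.exp (-(s * |(k i : ℝ)|)) := by
        simp only [l1Norm, latticePoint, ← Real.exp_sum, Finset.mul_sum, Finset.sum_neg_distrib]
    _ = ∏ i, ∑ m ∈ T i, Real.exp (-(s * |(m : ℝ)|)) :=
        (Finset.prod_univ_sum T fun _ m => Real.exp (-(s * |(m : ℝ)|))).symm
    _ ≤ ∏ _i : ι, (2 + 2 / s) :=
        Finset.prod_le_prod (fun _ _ => Finset.sum_nonneg fun _ _ => (Real.exp_pos _).le)
          fun i _ => sum_exp_neg_abs_le hs (T i)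
    _ = _ := by rw [Finset.prod_const, Finset.card_univ]

theorem sum_le_of_sum_fiber_le {α β : Type*} {F : α × β → ℝ} (hF : ∀ p, 0 ≤ F p) {G : β → ℝ}
    {C : ℝ} (hfiber : ∀ (T : Finset α) (b : β), ∑ a ∈ T, F (a, b) ≤ G b)
    (hG : ∀ U : Finset β, ∑ b ∈ U, G b ≤ C) (S : Finset (α × β)) : ∑ p ∈ S, F p ≤ C := by
  classical
  calc ∑ p ∈ S, F p ≤ ∑ p ∈ S.image Prod.fst ×ˢ S.image Prod.snd, F p :=
        Finset.sum_le_sum_of_subset_of_nonneg Finset.subset_product fun p _ _ => hF p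
    _ = ∑ b ∈ S.image Prod.snd, ∑ a ∈ S.image Prod.fst, F (a, b) := Finset.sum_product_right _ _ _
    _ ≤ C := (Finset.sum_le_sum fun b _ => hfiber _ b).trans (hG _)

/-- The half-open unit cube with lower corner the lattice point `k`. -/
def unitCell {ι : Type*} (k : ι → ℤ) : Set (ι → ℝ) := {x | ∀ i, ⌊x i⌋ = k i}

theorem unitCell_eq_pi {ι : Type*} (k : ι → ℤ) :
    unitCell k = Set.univ.pi fun i => Set.Ico (k i : ℝ) (k i + 1) := by
  ext x
  simp [unitCell, Int.floor_eq_iff]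

theorem mem_Icc_of_mem_unitCell_zero {ι : Type*} {x : ι → ℝ} (hx : x ∈ unitCell 0) :
    x ∈ Set.Icc 0 1 := by
  simp only [unitCell_eq_pi, Set.mem_univ_pi, Pi.zero_apply, Int.cast_zero, zero_add,
    Set.mem_Ico] at hx
  exact ⟨fun i => (hx i).1, fun i => (hx i).2.le⟩

theorem measurableSet_unitCell {ι : Type*} [Countable ι] (k : ι → ℤ) :
    MeasurableSet (unitCell k) := by
  rw [unitCell_eq_pi]
  exact MeasurableSet.univ_pi fun i => measurableSet_Ico

section Lattice

variable {ι : Type*} [Fintype ι]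

theorem volume_unitCell (k : ι → ℤ) : volume (unitCell k) = 1 := by
  rw [unitCell_eq_pi, Real.volume_pi_Ico]
  simp

theorem hasSum_setIntegral_unitCell {F : (ι → ℝ) → ℝ} (hF : Integrable F) :
    HasSum (fun k => ∫ x in unitCell k, F x) (∫ x, F x) := by
  have hcover : ⋃ k, unitCell k = (Set.univ : Set (ι → ℝ)) :=
    Set.eq_univ_of_forall fun x => Set.mem_iUnion.2 ⟨fun i => ⌊x i⌋, fun _ => rfl⟩
  have hdisjoint : Pairwise (Function.onFun Disjoint (unitCell (ι := ι))) := fun k l hkl =>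
    Set.disjoint_left.2 fun x hk hl => hkl (funext fun i => (hk i).symm.trans (hl i))
  simpa [hcover] using
    hasSum_integral_iUnion (μ := volume) measurableSet_unitCell hdisjoint hF.integrableOn

theorem setIntegral_unitCell (F : (ι → ℝ) → ℝ) (k : ι → ℤ) :
    ∫ x in unitCell k, F x = ∫ x in unitCell 0, F (latticePoint k + x) := by
  have hpreimage : (fun x => latticePoint k + x) ⁻¹' unitCell k = unitCell 0 := by
    ext x
    simp [unitCell, latticePoint]
  rw [← hpreimage]
  exact ((measurePreserving_add_left volume (latticePoint k)).setIntegral_preimage_emb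
    (measurableEmbedding_addLeft _) F (unitCell k)).symm

theorem abs_sub_setIntegral_unitCell_le {F : (ι → ℝ) → ℝ} (hF : Integrable F) (k : ι → ℤ) :
    |F (latticePoint k) - ∫ x in unitCell k, F x| ≤
      ∫ x in unitCell 0, |F (latticePoint k) - F (latticePoint k + x)| := by
  have hconst : IntegrableOn (fun _ => F (latticePoint k)) (unitCell (0 : ι → ℤ)) :=
    integrableOn_const (by simp [volume_unitCell])
  have haverage : F (latticePoint k) - ∫ x in unitCell k, F x =
      ∫ x in unitCell 0, (F (latticePoint k) - F (latticePoint k + x)) := by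
    rw [integral_sub hconst (hF.comp_add_left _).integrableOn, setIntegral_unitCell]
    simp [measureReal_def, volume_unitCell]
  rw [haverage]
  exact abs_integral_le_integral_abs

section RiemannSum

variable {F : (ι → ℝ) → ℝ} (hF : Integrable F) {C : ℝ}
  (hosc : ∀ x ∈ Set.Icc (0 : ι → ℝ) 1, ∀ S : Finset (ι → ℤ),
    ∑ k ∈ S, |F (latticePoint k) - F (latticePoint k + x)| ≤ C)

include hF hosc

theorem sum_abs_sub_setIntegral_unitCell_le (S : Finset (ι → ℤ)) :
    ∑ k ∈ S, |F (latticePoint k) - ∫ x in unitCell k, F x| ≤ C := by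
  have hint : ∀ k : ι → ℤ, IntegrableOn
      (fun x => |F (latticePoint k) - F (latticePoint k + x)|) (unitCell 0) := fun k =>
    ((integrableOn_const (by simp [volume_unitCell])).sub
      (hF.comp_add_left _).integrableOn).abs
  calc ∑ k ∈ S, |F (latticePoint k) - ∫ x in unitCell k, F x|
      ≤ ∑ k ∈ S, ∫ x in unitCell 0, |F (latticePoint k) - F (latticePoint k + x)| :=
        Finset.sum_le_sum fun k _ => abs_sub_setIntegral_unitCell_le hF k
    _ = ∫ x in unitCell 0, ∑ k ∈ S, |F (latticePoint k) - F (latticePoint k + x)| :=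
        (integral_finsetSum _ fun k _ => hint k).symm
    _ ≤ ∫ _x in unitCell (0 : ι → ℤ), C :=
        setIntegral_mono_on (integrable_finsetSum _ fun k _ => hint k)
          (integrableOn_const (by simp [volume_unitCell])) (measurableSet_unitCell 0)
          fun x hx => hosc x (mem_Icc_of_mem_unitCell_zero hx) S
    _ = C := by simp [measureReal_def, volume_unitCell]

theorem summable_and_abs_tsum_sub_integral_le :
    Summable (fun k => F (latticePoint k)) ∧ |∑' k, F (latticePoint k) - ∫ x, F x| ≤ C := by
  have hsum_le := sum_abs_sub_setIntegral_unitCell_le hF hosc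
  have habs : Summable fun k => |F (latticePoint k) - ∫ x in unitCell k, F x| :=
    summable_of_sum_le (fun _ => abs_nonneg _) hsum_le
  have hcells := hasSum_setIntegral_unitCell hF
  have hsum : Summable fun k => F (latticePoint k) := by
    simpa using habs.of_abs.add hcells.summable
  refine ⟨hsum, ?_⟩
  rw [← hcells.tsum_eq, ← hsum.tsum_sub hcells.summable]
  have htriangle := norm_tsum_le_tsum_norm habs.of_abs.norm
  simp only [Real.norm_eq_abs] at htriangle
  exact htriangle.trans (habs.tsum_le_of_sum_le hsum_le)

end RiemannSum

end Lattice

theorem l1Norm_le_l1Norm_add_add_card {ι : Type*} [Fintype ι] (x : ι → ℝ) {y : ι → ℝ}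
    (hy : y ∈ Set.Icc 0 1) : l1Norm x ≤ l1Norm (x + y) + Fintype.card ι := by
  calc l1Norm x ≤ ∑ i, (|(x + y) i| + 1) := Finset.sum_le_sum fun i _ => by
        have hsub := abs_sub (x i + y i) (y i)
        rw [add_sub_cancel_right, abs_of_nonneg (hy.1 i)] at hsub
        exact hsub.trans (add_le_add_right (hy.2 i) _)
    _ = _ := by simp [Finset.sum_add_distrib, l1Norm]

section Fibers

variable {ι : Type*} [DecidableEq ι]

theorem latticePoint_funSplitAt_symm (j : ι) (m : ℤ) (l : {i // i ≠ j} → ℤ) :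
    latticePoint ((Equiv.funSplitAt j ℤ).symm (m, l)) =
      latticePoint ((Equiv.funSplitAt j ℤ).symm (0, l)) + (m : ℝ) • Pi.single j 1 := by
  ext i
  rcases eq_or_ne i j with rfl | hi
  · simp [latticePoint]
  · simp [latticePoint, hi]

variable [Fintype ι]

theorem l1Norm_latticePoint_le_funSplitAt_symm (j : ι) (m : ℤ) (l : {i // i ≠ j} → ℤ) :
    l1Norm (latticePoint l) ≤ l1Norm (latticePoint ((Equiv.funSplitAt j ℤ).symm (m, l))) := by
  rw [l1Norm, l1Norm, Fintype.sum_eq_add_sum_subtype_ne _ j]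
  exact le_add_of_nonneg_of_le (abs_nonneg _) <| le_of_eq <|
    Finset.sum_congr rfl fun i _ => by simp [latticePoint, i.2]

variable {g : (ι → ℝ) → ℝ} (hq : QuasiconcaveOn ℝ Set.univ g) (hnonneg : ∀ x, 0 ≤ g x) {B : ℝ}
  (hB : ∀ x, g x ≤ B) {a : ℝ} (ha : 0 < a) (u : ι → ℝ) (j : ι) {t : ℝ} (ht : t ∈ Set.Icc 0 1)

include hq hnonneg hB ha ht

theorem sum_fiber_exp_neg_l1Norm_mul_abs_sub_le (T : Finset ℤ) (l : {i // i ≠ j} → ℤ) :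
    ∑ m ∈ T, Real.exp (-(a * l1Norm (latticePoint ((Equiv.funSplitAt j ℤ).symm (m, l))))) *
        |g (latticePoint ((Equiv.funSplitAt j ℤ).symm (m, l)) + u) -
          g (latticePoint ((Equiv.funSplitAt j ℤ).symm (m, l)) + (u + t • Pi.single j 1))| ≤
      Real.exp (-(a * l1Norm (latticePoint l))) * (2 * B) := by
  let z := latticePoint ((Equiv.funSplitAt j ℤ).symm (0, l)) + u
  have hvariation := sum_abs_sub_le_of_quasiconcaveOn
    (quasiconcaveOn_univ_comp_affineMap hq (AffineMap.lineMap z (z + Pi.single j 1)))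
    (fun _ => hnonneg _) ht (fun _ => hB _) T
  refine le_trans ?_ (mul_le_mul_of_nonneg_left hvariation (Real.exp_pos _).le)
  rw [Finset.mul_sum]
  refine Finset.sum_le_sum fun m _ => mul_le_mul (Real.exp_le_exp.2 ?_) (le_of_eq ?_)
    (abs_nonneg _) (Real.exp_pos _).le
  · exact neg_le_neg
      (mul_le_mul_of_nonneg_left (l1Norm_latticePoint_le_funSplitAt_symm j m l) ha.le)
  · simp only [latticePoint_funSplitAt_symm j m l, Function.comp_apply, AffineMap.lineMap_apply,
      vsub_eq_sub, vadd_eq_add, add_sub_cancel_left, z]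
    congr 3 <;> module

theorem sum_exp_neg_l1Norm_mul_abs_sub_le (S : Finset (ι → ℤ)) :
    ∑ k ∈ S, Real.exp (-(a * l1Norm (latticePoint k))) *
        |g (latticePoint k + u) - g (latticePoint k + (u + t • Pi.single j 1))| ≤
      2 * B * (2 + 2 / a) ^ (Fintype.card ι - 1) := by
  have hB0 : 0 ≤ B := (hnonneg 0).trans (hB 0)
  have hbases : ∀ U : Finset ({i // i ≠ j} → ℤ),
      ∑ l ∈ U, Real.exp (-(a * l1Norm (latticePoint l))) * (2 * B) ≤
        2 * B * (2 + 2 / a) ^ (Fintype.card ι - 1) := fun U => by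
    have hcard : Fintype.card {i // i ≠ j} = Fintype.card ι - 1 := by simp
    rw [← Finset.sum_mul, mul_comm, ← hcard]
    exact mul_le_mul_of_nonneg_left (sum_exp_neg_l1Norm_le ha U) (by positivity)
  let F : ℤ × ({i // i ≠ j} → ℤ) → ℝ := fun p =>
    Real.exp (-(a * l1Norm (latticePoint ((Equiv.funSplitAt j ℤ).symm p)))) *
      |g (latticePoint ((Equiv.funSplitAt j ℤ).symm p) + u) -
        g (latticePoint ((Equiv.funSplitAt j ℤ).symm p) + (u + t • Pi.single j 1))|
  have hF : ∀ p, 0 ≤ F p := fun _ => mul_nonneg (Real.exp_pos _).le (abs_nonneg _)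
  have hsplit := sum_le_of_sum_fiber_le hF
    (sum_fiber_exp_neg_l1Norm_mul_abs_sub_le hq hnonneg hB ha u j ht) hbases
    (S.map (Equiv.funSplitAt j ℤ).toEmbedding)
  simpa only [F, Finset.sum_map, Equiv.coe_toEmbedding, Equiv.symm_apply_apply] using hsplit

end Fibers

section Oscillation

variable {ι : Type*} [Fintype ι] {f : (ι → ℝ) → ℝ} {M a : ℝ}

theorem le_mul_exp_mul_exp_neg_l1Norm (hM : 0 ≤ M) (ha : 0 < a)
    (hfM : ∀ x, f x ≤ M * Real.exp (-(4 * a * l1Norm x))) (x : ι → ℝ) {y : ι → ℝ}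
    (hy : y ∈ Set.Icc 0 1) :
    f (x + y) ≤ M * Real.exp (4 * a * Fintype.card ι) * Real.exp (-(4 * a * l1Norm x)) := by
  refine (hfM _).trans ?_
  rw [mul_assoc M, ← Real.exp_add]
  refine mul_le_mul_of_nonneg_left (Real.exp_le_exp.2 ?_) hM
  nlinarith [l1Norm_le_l1Norm_add_add_card x hy]

/-- Writing `f (x + u) - f (x + v)` as a difference of squares of `√f`, one factor provides the
exponential decay and the other one keeps the bounded variation along lines. -/
theorem exp_mul_abs_sub_le_mul_abs_sqrt_sub (hnonneg : ∀ x, 0 ≤ f x) (hM : 0 ≤ M) (ha : 0 < a)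
    (hfM : ∀ x, f x ≤ M * Real.exp (-(4 * a * l1Norm x))) (x : ι → ℝ) {u v : ι → ℝ}
    (hu : u ∈ Set.Icc 0 1) (hv : v ∈ Set.Icc 0 1) :
    Real.exp (a * l1Norm x) * |f (x + u) - f (x + v)| ≤
      2 * √M * Real.exp (2 * a * Fintype.card ι) *
        (Real.exp (-(a * l1Norm x)) * |√(f (x + u)) - √(f (x + v))|) := by
  have hsqrt : ∀ y ∈ Set.Icc (0 : ι → ℝ) 1, √(f (x + y)) ≤
      √M * Real.exp (2 * a * Fintype.card ι) * Real.exp (-(2 * a * l1Norm x)) := fun y hy => by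
    refine (Real.sqrt_le_sqrt (le_mul_exp_mul_exp_neg_l1Norm hM ha hfM x hy)).trans_eq ?_
    rw [Real.sqrt_mul (by positivity), Real.sqrt_mul hM, ← Real.exp_half, ← Real.exp_half]
    ring_nf
  have hfactor : |f (x + u) - f (x + v)| =
      (√(f (x + u)) + √(f (x + v))) * |√(f (x + u)) - √(f (x + v))| := by
    rw [← abs_of_nonneg (add_nonneg (Real.sqrt_nonneg (f (x + u))) (Real.sqrt_nonneg _)),
      ← abs_mul, ← sq_sub_sq, Real.sq_sqrt (hnonneg _), Real.sq_sqrt (hnonneg _)]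
  have hexp : Real.exp (-(a * l1Norm x)) =
      Real.exp (a * l1Norm x) * Real.exp (-(2 * a * l1Norm x)) := by
    rw [← Real.exp_add]
    ring_nf
  rw [hfactor, ← mul_assoc, ← mul_assoc, hexp]
  refine mul_le_mul_of_nonneg_right ?_ (abs_nonneg _)
  nlinarith [mul_le_mul_of_nonneg_left (add_le_add (hsqrt u hu) (hsqrt v hv))
    (Real.exp_pos (a * l1Norm x)).le]

theorem sum_exp_mul_abs_sub_add_smul_single_le [DecidableEq ι]
    (hq : QuasiconcaveOn ℝ Set.univ f) (hnonneg : ∀ x, 0 ≤ f x) (hM : 0 ≤ M) (ha : 0 < a)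
    (hfM : ∀ x, f x ≤ M * Real.exp (-(4 * a * l1Norm x))) {u : ι → ℝ} {j : ι} {t : ℝ}
    (ht : t ∈ Set.Icc 0 1) (hu : u ∈ Set.Icc 0 1) (hut : u + t • Pi.single j 1 ∈ Set.Icc 0 1)
    (S : Finset (ι → ℤ)) :
    ∑ k ∈ S, Real.exp (a * l1Norm (latticePoint k)) *
        |f (latticePoint k + u) - f (latticePoint k + (u + t • Pi.single j 1))| ≤
      4 * M * Real.exp (2 * a * Fintype.card ι) * (2 + 2 / a) ^ (Fintype.card ι - 1) := by
  have hsqrt_le : ∀ x, √(f x) ≤ √M := fun x => Real.sqrt_le_sqrt <| (hfM x).trans <|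
    mul_le_of_le_one_right hM <| Real.exp_le_one_iff.2 <|
      neg_nonpos.2 (mul_nonneg (by positivity) (l1Norm_nonneg x))
  have hsqrt_sum := sum_exp_neg_l1Norm_mul_abs_sub_le
    (hq.monotone_comp Real.sqrt_monotone) (fun _ => Real.sqrt_nonneg _) hsqrt_le ha u j ht S
  refine (Finset.sum_le_sum fun k _ => exp_mul_abs_sub_le_mul_abs_sqrt_sub hnonneg hM ha hfM
    (latticePoint k) hu hut).trans ?_
  rw [← Finset.mul_sum]
  refine (mul_le_mul_of_nonneg_left hsqrt_sum (by positivity)).trans_eq ?_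
  nth_rw 3 [← Real.mul_self_sqrt hM]
  ring

theorem sum_exp_mul_abs_sub_le (hq : QuasiconcaveOn ℝ Set.univ f) (hnonneg : ∀ x, 0 ≤ f x)
    (hM : 0 ≤ M) (ha : 0 < a) (hfM : ∀ x, f x ≤ M * Real.exp (-(4 * a * l1Norm x)))
    {x : ι → ℝ} (hx : x ∈ Set.Icc 0 1) (S : Finset (ι → ℤ)) :
    ∑ k ∈ S, Real.exp (a * l1Norm (latticePoint k)) *
        |f (latticePoint k) - f (latticePoint k + x)| ≤
      Fintype.card ι *
        (4 * M * Real.exp (2 * a * Fintype.card ι) * (2 + 2 / a) ^ (Fintype.card ι - 1)) := by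
  classical
  set B := 4 * M * Real.exp (2 * a * Fintype.card ι) * (2 + 2 / a) ^ (Fintype.card ι - 1)
  have hmem : ∀ s : Finset ι, s.piecewise x 0 ∈ Set.Icc (0 : ι → ℝ) 1 := fun s =>
    s.piecewise_mem_Icc_of_mem_of_mem hx ⟨le_rfl, zero_le_one⟩
  have hpartial : ∀ s : Finset ι, ∑ k ∈ S, Real.exp (a * l1Norm (latticePoint k)) *
      |f (latticePoint k) - f (latticePoint k + s.piecewise x 0)| ≤ s.card * B := fun s => by
    induction s using Finset.induction_on with
    | empty => simp
    | insert j s hj ih =>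
      have hstep : (insert j s).piecewise x 0 = s.piecewise x 0 + x j • Pi.single j 1 := by
        ext i
        rcases eq_or_ne i j with rfl | hi
        · simp [hj]
        · by_cases his : i ∈ s <;> simp [hi, his]
      have hcoord := sum_exp_mul_abs_sub_add_smul_single_le hq hnonneg hM ha hfM
        ⟨hx.1 j, hx.2 j⟩ (hmem s) (hstep ▸ hmem (insert j s)) S
      rw [← hstep] at hcoord
      calc _ ≤ ∑ k ∈ S, (Real.exp (a * l1Norm (latticePoint k)) *
              |f (latticePoint k) - f (latticePoint k + s.piecewise x 0)| +
            Real.exp (a * l1Norm (latticePoint k)) *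
              |f (latticePoint k + s.piecewise x 0) -
                f (latticePoint k + (insert j s).piecewise x 0)|) :=
            Finset.sum_le_sum fun k _ => by
              rw [← mul_add]
              exact mul_le_mul_of_nonneg_left (abs_sub_le _ _ _) (Real.exp_pos _).le
        _ ≤ s.card * B + B := by
            rw [Finset.sum_add_distrib]
            exact add_le_add ih hcoord
        _ = _ := by
            rw [Finset.card_insert_of_notMem hj]
            push_cast
            ring
  simpa using hpartial Finset.univ

/-- `φ` is a weight of size `P` and oscillation `Q` over unit cubes, up to the exponential factor
`exp (a * l1Norm k)`; lattice sums of `φ * f` for exponentially decaying quasiconcave `f` are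
compared with integrals for such weights. -/
structure HasLatticeGrowth (φ : (ι → ℝ) → ℝ) (a P Q : ℝ) : Prop where
  abs_le : ∀ k, |φ (latticePoint k)| ≤ P * Real.exp (a * l1Norm (latticePoint k))
  abs_sub_le : ∀ k, ∀ x ∈ Set.Icc (0 : ι → ℝ) 1,
    |φ (latticePoint k) - φ (latticePoint k + x)| ≤ Q * Real.exp (a * l1Norm (latticePoint k))

theorem HasLatticeGrowth.nonneg_left {φ : (ι → ℝ) → ℝ} {P Q : ℝ}
    (hφ : HasLatticeGrowth φ a P Q) : 0 ≤ P :=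
  nonneg_of_mul_nonneg_left ((abs_nonneg _).trans (hφ.abs_le 0)) (Real.exp_pos _)

theorem HasLatticeGrowth.nonneg_right {φ : (ι → ℝ) → ℝ} {P Q : ℝ}
    (hφ : HasLatticeGrowth φ a P Q) : 0 ≤ Q :=
  nonneg_of_mul_nonneg_left ((abs_nonneg _).trans
    (hφ.abs_sub_le 0 0 ⟨le_rfl, zero_le_one⟩)) (Real.exp_pos _)

theorem HasLatticeGrowth.sum_abs_mul_sub_mul_le {φ : (ι → ℝ) → ℝ} {P Q : ℝ}
    (hφ : HasLatticeGrowth φ a P Q) (hq : QuasiconcaveOn ℝ Set.univ f) (hnonneg : ∀ x, 0 ≤ f x)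
    (hM : 0 ≤ M) (ha : 0 < a) (hfM : ∀ x, f x ≤ M * Real.exp (-(4 * a * l1Norm x)))
    {x : ι → ℝ} (hx : x ∈ Set.Icc 0 1) (S : Finset (ι → ℤ)) :
    ∑ k ∈ S, |φ (latticePoint k) * f (latticePoint k) -
        φ (latticePoint k + x) * f (latticePoint k + x)| ≤
      P * (Fintype.card ι *
        (4 * M * Real.exp (2 * a * Fintype.card ι) * (2 + 2 / a) ^ (Fintype.card ι - 1))) +
      Q * (M * Real.exp (4 * a * Fintype.card ι) * (2 + 2 / a) ^ Fintype.card ι) := by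
  have hweight_oscillation : ∀ k : ι → ℤ,
      |φ (latticePoint k) - φ (latticePoint k + x)| * f (latticePoint k + x) ≤
        Q * (M * Real.exp (4 * a * Fintype.card ι) *
          Real.exp (-(a * l1Norm (latticePoint k)))) := fun k => by
    refine (mul_le_mul (hφ.abs_sub_le k x hx) (le_mul_exp_mul_exp_neg_l1Norm hM ha hfM _ hx)
      (hnonneg _) (mul_nonneg hφ.nonneg_right (Real.exp_pos _).le)).trans ?_
    rw [mul_assoc, mul_left_comm (Real.exp _), ← Real.exp_add]
    refine mul_le_mul_of_nonneg_left (mul_le_mul_of_nonneg_left (Real.exp_le_exp.2 ?_)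
      (by positivity)) hφ.nonneg_right
    nlinarith [mul_nonneg ha.le (l1Norm_nonneg (latticePoint k))]
  have hterm : ∀ k : ι → ℤ, |φ (latticePoint k) * f (latticePoint k) -
        φ (latticePoint k + x) * f (latticePoint k + x)| ≤
      P * (Real.exp (a * l1Norm (latticePoint k)) *
        |f (latticePoint k) - f (latticePoint k + x)|) +
      Q * (M * Real.exp (4 * a * Fintype.card ι) *
        Real.exp (-(a * l1Norm (latticePoint k)))) := fun k => by
    calc _ = |φ (latticePoint k) * (f (latticePoint k) - f (latticePoint k + x)) +
          (φ (latticePoint k) - φ (latticePoint k + x)) * f (latticePoint k + x)| := by ring_nf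
      _ ≤ |φ (latticePoint k)| * |f (latticePoint k) - f (latticePoint k + x)| +
          |φ (latticePoint k) - φ (latticePoint k + x)| * f (latticePoint k + x) := by
          refine (abs_add_le _ _).trans_eq ?_
          rw [abs_mul, abs_mul, abs_of_nonneg (hnonneg (latticePoint k + x))]
      _ ≤ _ := by
          rw [← mul_assoc P]
          exact add_le_add (mul_le_mul_of_nonneg_right (hφ.abs_le k) (abs_nonneg _))
            (hweight_oscillation k)
  refine (Finset.sum_le_sum fun k _ => hterm k).trans ?_
  rw [Finset.sum_add_distrib, ← Finset.mul_sum, ← Finset.mul_sum, ← Finset.mul_sum]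
  have hP := hφ.nonneg_left
  have hQ := hφ.nonneg_right
  gcongr
  · exact sum_exp_mul_abs_sub_le hq hnonneg hM ha hfM hx S
  · exact sum_exp_neg_l1Norm_le ha S

/-- The factor, depending only on the dimension, in the error of the comparison of lattice sums
with integrals. -/
noncomputable def latticeErrorConst (d : ℕ) : ℝ := (d + 1) * 4 ^ d * Real.exp (4 * d)

theorem latticeErrorConst_pos (d : ℕ) : 0 < latticeErrorConst d := by
  unfold latticeErrorConst
  positivity

theorem HasLatticeGrowth.summable_and_abs_tsum_sub_integral_le {φ : (ι → ℝ) → ℝ} {P Q A : ℝ}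
    (hφ : HasLatticeGrowth φ a P Q) (hint : Integrable fun x => φ x * f x)
    (hq : QuasiconcaveOn ℝ Set.univ f) (hnonneg : ∀ x, 0 ≤ f x) (hA : 0 ≤ A) (ha : 0 < a)
    (ha1 : a ≤ 1)
    (hfA : ∀ x, f x ≤ A * a ^ Fintype.card ι * Real.exp (-(4 * a * l1Norm x))) :
    Summable (fun k => φ (latticePoint k) * f (latticePoint k)) ∧
      |∑' k, φ (latticePoint k) * f (latticePoint k) - ∫ x, φ x * f x| ≤
        latticeErrorConst (Fintype.card ι) * A * (a * P + Q) := by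
  set d := Fintype.card ι
  have hP := hφ.nonneg_left
  have hQ := hφ.nonneg_right
  have hgeom : 2 + 2 / a ≤ 4 / a := by
    have : 2 ≤ 2 / a := (le_div_iff₀ ha).2 (by linarith)
    calc 2 + 2 / a ≤ 2 / a + 2 / a := by linarith
      _ = 4 / a := by ring
  have hpow : 4 * (d * (a ^ d * (4 / a) ^ (d - 1))) = d * (4 ^ d * a) := by
    rcases d.eq_zero_or_pos with h0 | hd
    · simp [h0]
    rw [div_pow, ← pow_sub_one_mul hd.ne' a, ← pow_sub_one_mul hd.ne' (4 : ℝ)]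
    field_simp
  have hexp : Real.exp (4 * a * d) ≤ Real.exp (4 * d) := by
    gcongr
    linarith
  have hexp' : Real.exp (2 * a * d) ≤ Real.exp (4 * d) := by
    gcongr
    linarith
  refine _root_.summable_and_abs_tsum_sub_integral_le hint fun x hx S =>
    (hφ.sum_abs_mul_sub_mul_le hq hnonneg (by positivity) ha hfA hx S).trans ?_
  calc P * (d * (4 * (A * a ^ d) * Real.exp (2 * a * d) * (2 + 2 / a) ^ (d - 1))) +
        Q * (A * a ^ d * Real.exp (4 * a * d) * (2 + 2 / a) ^ d)
      ≤ P * (d * (4 * (A * a ^ d) * Real.exp (4 * d) * (4 / a) ^ (d - 1))) +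
        Q * (A * a ^ d * Real.exp (4 * d) * (4 / a) ^ d) := by gcongr
    _ = P * A * Real.exp (4 * d) * (4 * (d * (a ^ d * (4 / a) ^ (d - 1)))) +
        Q * A * Real.exp (4 * d) * 4 ^ d := by
        rw [div_pow 4 a d]
        field_simp
    _ = A * 4 ^ d * Real.exp (4 * d) * (d * (a * P) + Q) := by
        rw [hpow]
        ring
    _ ≤ A * 4 ^ d * Real.exp (4 * d) * ((d + 1) * (a * P + Q)) := by
        gcongr
        nlinarith [mul_nonneg ha.le hP, mul_nonneg d.cast_nonneg hQ]
    _ = _ := by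
        rw [latticeErrorConst]
        ring

end Oscillation

section LatticeGrowth

theorem abs_apply_le_one_of_mem_Icc {ι : Type*} {x : ι → ℝ} (hx : x ∈ Set.Icc 0 1) (i : ι) :
    |x i| ≤ 1 := by
  rw [abs_of_nonneg (hx.1 i)]
  exact hx.2 i

variable {ι : Type*} [Fintype ι] {a : ℝ}

theorem abs_apply_le_l1Norm (x : ι → ℝ) (i : ι) : |x i| ≤ l1Norm x :=
  Finset.single_le_sum (f := fun i => |x i|) (fun _ _ => abs_nonneg _) (Finset.mem_univ i)

theorem one_le_exp_mul_l1Norm (ha : 0 ≤ a) (x : ι → ℝ) : 1 ≤ Real.exp (a * l1Norm x) :=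
  Real.one_le_exp (mul_nonneg ha (l1Norm_nonneg x))

theorem le_inv_mul_exp (ha : 0 < a) (s : ℝ) : s ≤ 1 / a * Real.exp (a * s) := by
  rw [one_div, le_inv_mul_iff₀ ha]
  linarith [Real.add_one_le_exp (a * s)]

theorem sq_le_two_div_sq_mul_exp (ha : 0 < a) {s : ℝ} (hs : 0 ≤ s) :
    s ^ 2 ≤ 2 / a ^ 2 * Real.exp (a * s) := by
  rw [div_mul_eq_mul_div, le_div_iff₀ (by positivity)]
  nlinarith [Real.quadratic_le_exp_of_nonneg (mul_nonneg ha.le hs), mul_nonneg ha.le hs]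

theorem hasLatticeGrowth_one (ha : 0 ≤ a) :
    HasLatticeGrowth (fun _ : ι → ℝ => 1) a 1 0 where
  abs_le k := by simpa using one_le_exp_mul_l1Norm ha (latticePoint k)
  abs_sub_le k x _ := by simp

theorem hasLatticeGrowth_apply (ha : 0 < a) (i : ι) :
    HasLatticeGrowth (fun x : ι → ℝ => x i) a (1 / a) 1 where
  abs_le k := (abs_apply_le_l1Norm _ i).trans (le_inv_mul_exp ha _)
  abs_sub_le k x hx := by
    simpa using (abs_apply_le_one_of_mem_Icc hx i).trans
      (one_le_exp_mul_l1Norm ha.le (latticePoint k))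

theorem hasLatticeGrowth_apply_mul_apply (ha : 0 < a) (i j : ι) :
    HasLatticeGrowth (fun x : ι → ℝ => x i * x j) a (2 / a ^ 2) (2 / a + 1) where
  abs_le k := by
    refine le_trans ?_ (sq_le_two_div_sq_mul_exp ha (l1Norm_nonneg _))
    rw [abs_mul, sq]
    exact mul_le_mul (abs_apply_le_l1Norm _ i) (abs_apply_le_l1Norm _ j) (abs_nonneg _)
      (l1Norm_nonneg _)
  abs_sub_le k x hx := by
    set y := latticePoint k
    have hi := abs_apply_le_one_of_mem_Icc hx i
    have hj := abs_apply_le_one_of_mem_Icc hx j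
    calc |y i * y j - (y + x) i * (y + x) j| = |y i * x j + x i * y j + x i * x j| := by
          rw [Pi.add_apply, Pi.add_apply, ← abs_neg]
          ring_nf
      _ ≤ |y i| * |x j| + |x i| * |y j| + |x i| * |x j| := by
          simpa only [abs_mul] using abs_add_three (y i * x j) (x i * y j) (x i * x j)
      _ ≤ l1Norm y * 1 + 1 * l1Norm y + 1 * 1 := by
          gcongr
          exacts [l1Norm_nonneg y, abs_apply_le_l1Norm y i, abs_apply_le_l1Norm y j]
      _ ≤ 2 * (1 / a * Real.exp (a * l1Norm y)) + Real.exp (a * l1Norm y) := by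
          linarith [le_inv_mul_exp ha (l1Norm y), one_le_exp_mul_l1Norm ha.le y]
      _ = (2 / a + 1) * Real.exp (a * l1Norm y) := by ring

end LatticeGrowth

theorem exists_lattice_sum_error_le (d : ℕ) :
    ∃ D > 0, ∃ α > 0, ∀ (f : (Fin d → ℝ) → ℝ) (σ : ℝ), IsLogConcave f → 1 ≤ σ →
      IsIsotropicDensity f σ → ∀ {φ : (Fin d → ℝ) → ℝ} {P Q : ℝ},
        HasLatticeGrowth φ (α / σ) P Q → Integrable (fun x => φ x * f x) →
        Summable (fun k => φ (latticePoint k) * f (latticePoint k)) ∧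
          |∑' k, φ (latticePoint k) * f (latticePoint k) - ∫ x, φ x * f x| ≤
            D * (α / σ * P + Q) := by
  obtain ⟨A, α, hA, hα, hα1, hdecay⟩ := exists_isotropic_le_exp_neg_l1Norm d
  refine ⟨latticeErrorConst d * A, mul_pos (latticeErrorConst_pos d) hA, α, hα, ?_⟩
  intro f σ hf hσ h φ P Q hφ hint
  have hσ0 : 0 < σ := by linarith
  have hbound := hφ.summable_and_abs_tsum_sub_integral_le hint hf.quasiconcaveOn hf.1 hA.le
    (div_pos hα hσ0) ((div_le_one hσ0).2 (hα1.trans hσ)) (by simpa using hdecay f σ hf h)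
  simpa using hbound

theorem exists_lattice_moments_le (d : ℕ) :
    ∃ D > 0, ∀ (f : (Fin d → ℝ) → ℝ) (σ : ℝ), IsLogConcave f → 1 ≤ σ → IsIsotropicDensity f σ →
      (Summable (latticeRestrict f) ∧ |∑' k, latticeRestrict f k - 1| ≤ D / σ) ∧
      (∀ i, (Summable fun k : Fin d → ℤ => (k i : ℝ) * latticeRestrict f k) ∧
        |∑' k : Fin d → ℤ, (k i : ℝ) * latticeRestrict f k| ≤ D) ∧
      (∀ i j, (Summable fun k : Fin d → ℤ => (k i : ℝ) * (k j : ℝ) * latticeRestrict f k) ∧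
        |∑' k : Fin d → ℤ, (k i : ℝ) * (k j : ℝ) * latticeRestrict f k -
          (σ ^ 2 • (1 : Matrix _ _ ℝ)) i j| ≤ D * σ) := by
  obtain ⟨D, hD, α, hα, herror⟩ := exists_lattice_sum_error_le d
  refine ⟨D * (α + 4 / α + 2), by positivity, fun f σ hf hσ h => ?_⟩
  have hσ0 : 0 < σ := by linarith
  have ha : 0 < α / σ := div_pos hα hσ0
  refine ⟨?_, fun i => ?_, fun i j => ?_⟩
  · have hmass := herror f σ hf hσ h (hasLatticeGrowth_one ha.le)
      (by simpa using h.isDensity.2.1)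
    simp only [one_mul, h.isDensity.2.2, mul_one, add_zero] at hmass
    refine ⟨hmass.1, hmass.2.trans ?_⟩
    rw [mul_div_assoc]
    gcongr
    have : 0 < 4 / α := by positivity
    linarith
  · have hmean := herror f σ hf hσ h (hasLatticeGrowth_apply ha i) (h.integrable_coord i)
    rw [h.isCentered i, sub_zero, mul_one_div_cancel ha.ne'] at hmean
    refine ⟨hmean.1, hmean.2.trans (mul_le_mul_of_nonneg_left ?_ hD.le)⟩
    have : 0 < 4 / α := by positivity
    linarith
  · have hsecond := herror f σ hf hσ h (hasLatticeGrowth_apply_mul_apply ha i j)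
      (h.integrable_coord_mul i j)
    rw [h.integral_coord_mul i j] at hsecond
    refine ⟨hsecond.1, hsecond.2.trans ?_⟩
    rw [mul_assoc]
    gcongr
    have : 0 < α * σ := by positivity
    calc α / σ * (2 / (α / σ) ^ 2) + (2 / (α / σ) + 1) = 4 / α * σ + 1 := by
          field_simp
          ring
      _ ≤ (α + 4 / α + 2) * σ := by linarith

theorem abs_div_sub_mul_div_sq_sub_le {S₀ S₁ S₁' S₂ δ D σ : ℝ} (hσ : 1 ≤ σ)
    (h₀ : |S₀ - 1| ≤ D / σ) (hhalf : 1 / 2 ≤ S₀) (h₁ : |S₁| ≤ D) (h₁' : |S₁'| ≤ D)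
    (h₂ : |S₂ - δ| ≤ D * σ) (hδ : |δ| ≤ σ ^ 2) :
    |S₂ / S₀ - S₁ * S₁' / S₀ ^ 2 - δ| ≤ (4 * D + 4 * D ^ 2) * σ := by
  have : 0 < σ := by linarith
  have hS : 0 < S₀ := by linarith
  have hD : 0 ≤ D := (abs_nonneg _).trans h₁
  have hsecond : |(S₂ - δ - δ * (S₀ - 1)) / S₀| ≤ 4 * D * σ := by
    have hmass : |δ * (S₀ - 1)| ≤ D * σ := by
      rw [abs_mul]
      calc |δ| * |S₀ - 1| ≤ σ ^ 2 * (D / σ) := mul_le_mul hδ h₀ (abs_nonneg _) (sq_nonneg _)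
        _ = D * σ := by field_simp
    rw [abs_div, abs_of_pos hS, div_le_iff₀ hS]
    nlinarith [abs_sub (S₂ - δ) (δ * (S₀ - 1)),
      mul_le_mul_of_nonneg_left hhalf (by positivity : 0 ≤ 4 * D * σ)]
  have hmeans : |S₁ * S₁' / S₀ ^ 2| ≤ 4 * D ^ 2 := by
    have hnum : |S₁| * |S₁'| ≤ D * D := mul_le_mul h₁ h₁' (abs_nonneg _) hD
    have hden : (1 / 2 : ℝ) ^ 2 ≤ S₀ ^ 2 := pow_le_pow_left₀ (by norm_num) hhalf 2
    rw [abs_div, abs_of_pos (pow_pos hS 2), div_le_iff₀ (pow_pos hS 2), abs_mul]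
    nlinarith [mul_le_mul_of_nonneg_left hden (by positivity : 0 ≤ 4 * D ^ 2)]
  calc |S₂ / S₀ - S₁ * S₁' / S₀ ^ 2 - δ|
      = |(S₂ - δ - δ * (S₀ - 1)) / S₀ - S₁ * S₁' / S₀ ^ 2| := by
        congr 1
        field_simp
        ring
    _ ≤ 4 * D * σ + 4 * D ^ 2 := (abs_sub _ _).trans (add_le_add hsecond hmeans)
    _ ≤ 4 * D * σ + 4 * D ^ 2 * σ :=
        add_le_add_right (le_mul_of_one_le_right (by positivity) hσ) _
    _ = _ := by ring

theorem abs_smul_one_apply_le {ι : Type*} [DecidableEq ι] {c : ℝ} (hc : 0 ≤ c) (i j : ι) :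
    |(c • (1 : Matrix ι ι ℝ)) i j| ≤ c := by
  rcases eq_or_ne i j with rfl | hij
  · simp [abs_of_nonneg hc]
  · simpa [Matrix.one_apply_ne hij] using hc

theorem exists_abs_covZ_sub_le (d : ℕ) :
    ∃ D N : ℝ, 0 < D ∧ 0 < N ∧ ∀ (f : (Fin d → ℝ) → ℝ) (σ : ℝ), IsLogConcave f → N ≤ σ →
      IsIsotropicDensity f σ → HasCovZ (latticeRestrict f) ∧
        ∀ i j, |covZ (latticeRestrict f) i j - (σ ^ 2 • (1 : Matrix _ _ ℝ)) i j| ≤ D * σ := by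
  obtain ⟨D, hD, hmoments⟩ := exists_lattice_moments_le d
  refine ⟨4 * D + 4 * D ^ 2, 1 + 2 * D, by positivity, by positivity, fun f σ hf hN h => ?_⟩
  have hσ : 1 ≤ σ := by linarith
  obtain ⟨⟨hsum₀, h₀⟩, h₁, h₂⟩ := hmoments f σ hf hσ h
  have hhalf : 1 / 2 ≤ ∑' k, latticeRestrict f k := by
    have : D / σ ≤ 1 / 2 := by
      rw [div_le_iff₀ (by linarith)]
      linarith
    linarith [(abs_le.1 h₀).1]
  exact ⟨⟨hsum₀, fun i => (h₁ i).1, fun i j => (h₂ i j).1, by linarith⟩, fun i j =>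
    abs_div_sub_mul_div_sq_sub_le hσ h₀ hhalf (h₁ i).2 (h₁ j).2 (h₂ i j).2
      (abs_smul_one_apply_le (sq_nonneg σ) i j)⟩

/-! ### Perturbation of the determinant -/

section Determinant

variable {ι : Type*} [Fintype ι] [DecidableEq ι]

theorem abs_det_le_factorial_mul_prod_norm (M : Matrix ι ι ℝ) :
    |M.det| ≤ (Fintype.card ι).factorial * ∏ i, ‖M i‖ := by
  rw [← M.det_transpose, Matrix.det_apply, ← Fintype.card_perm, ← Finset.card_univ, ← nsmul_eq_mul]
  refine (Finset.abs_sum_le_sum_abs _ _).trans (Finset.sum_le_card_nsmul _ _ _ fun τ _ => ?_)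
  rw [Units.smul_def, zsmul_eq_mul, abs_mul, ← Int.cast_abs, Int.isUnit_iff_abs_eq.1 τ.sign.isUnit,
    Int.cast_one, one_mul, Finset.abs_prod]
  exact Finset.prod_le_prod (fun _ _ => abs_nonneg _) fun i _ => norm_le_pi_norm (M i) (τ i)

theorem abs_det_sub_det_le {A B : Matrix ι ι ℝ} {R ε : ℝ} (hR : 0 ≤ R) (hε : 0 ≤ ε)
    (hA : ∀ i j, |A i j| ≤ R) (hB : ∀ i j, |B i j| ≤ R) (hAB : ∀ i j, |A i j - B i j| ≤ ε) :
    |A.det - B.det| ≤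
      (Fintype.card ι).factorial * Fintype.card ι * R ^ (Fintype.card ι - 1) * ε := by
  have hnorm : ∀ {M : ι → ι → ℝ} {r : ℝ}, 0 ≤ r → (∀ i j, |M i j| ≤ r) → ‖M‖ ≤ r :=
    fun hr hM => (pi_norm_le_iff_of_nonneg hr).2 fun i => (pi_norm_le_iff_of_nonneg hr).2 (hM i)
  have hlipschitz :=
    (Matrix.detRowAlternating (n := ι) (R := ℝ)).toMultilinearMap.norm_image_sub_le_of_bound
      (Nat.cast_nonneg _) abs_det_le_factorial_mul_prod_norm A B
  refine hlipschitz.trans ?_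
  gcongr
  · exact le_max_of_le_left (norm_nonneg _)
  · exact max_le (hnorm hR hA) (hnorm hR hB)
  · exact hnorm hε hAB

theorem abs_det_sub_pow_le [Nonempty ι] {A : Matrix ι ι ℝ} {D σ : ℝ} (hD : 0 ≤ D) (hσ : 0 ≤ σ)
    (hDσ : D ≤ σ) (hA : ∀ i j, |A i j - (σ ^ 2 • (1 : Matrix ι ι ℝ)) i j| ≤ D * σ) :
    |A.det - σ ^ (2 * Fintype.card ι)| ≤
      (Fintype.card ι).factorial * Fintype.card ι * 2 ^ (Fintype.card ι - 1) * D *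
        σ ^ (2 * Fintype.card ι - 1) := by
  have hclose : D * σ ≤ σ ^ 2 := by nlinarith
  have hentry : ∀ i j, |A i j| ≤ 2 * σ ^ 2 := fun i j => by
    linarith [hA i j, abs_smul_one_apply_le (sq_nonneg σ) i j,
      abs_sub_abs_le_abs_sub (A i j) ((σ ^ 2 • (1 : Matrix ι ι ℝ)) i j)]
  have hdet := abs_det_sub_det_le (by positivity) (by positivity) hentry
    (fun i j => (abs_smul_one_apply_le (sq_nonneg σ) i j).trans (by linarith [sq_nonneg σ])) hA
  rw [Matrix.det_smul, Matrix.det_one, mul_one, ← pow_mul] at hdet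
  refine hdet.trans_eq ?_
  obtain ⟨n, hn⟩ := Nat.exists_eq_succ_of_ne_zero (Fintype.card_ne_zero (α := ι))
  rw [hn, show 2 * n.succ - 1 = 2 * n + 1 by omega, Nat.succ_sub_one, mul_pow]
  ring

end Determinant

theorem mainTheorem4 (d : ℕ) (hd : 1 ≤ d) :
    ∃ C N : ℝ, 0 < C ∧ 0 < N ∧
      ∀ (f : (Fin d → ℝ) → ℝ) (σ : ℝ),
        IsLogConcave f → IsDensity f → IsCentered f →
        0 < σ → covR f = σ ^ 2 • (1 : Matrix (Fin d) (Fin d) ℝ) →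
        N ≤ σ →
          HasCovZ (latticeRestrict f) ∧
          (∀ i, |covZ (latticeRestrict f) i i - σ ^ 2| ≤ C * σ) ∧
          (∀ i j, i ≠ j → |covZ (latticeRestrict f) i j| ≤ C * σ) ∧
          |(covZ (latticeRestrict f)).det - σ ^ (2 * d)| ≤ C * σ ^ (2 * d - 1) := by
  have : Nonempty (Fin d) := ⟨⟨0, hd⟩⟩
  obtain ⟨D, N, hD, hN, hcovZ⟩ := exists_abs_covZ_sub_le d
  set K : ℝ := d.factorial * d * 2 ^ (d - 1) * D
  refine ⟨D + K, D + N, by positivity, by positivity, fun f σ hf hdens hcent hσ hcov hNσ => ?_⟩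
  obtain ⟨hhas, hentry⟩ := hcovZ f σ hf (by linarith)
    (isIsotropicDensity_of_covR hdens hcent hσ hcov)
  have hentry' : ∀ i j, |covZ (latticeRestrict f) i j - (σ ^ 2 • (1 : Matrix _ _ ℝ)) i j| ≤
      (D + K) * σ := fun i j => (hentry i j).trans <|
    mul_le_mul_of_nonneg_right (le_add_of_nonneg_right (by positivity)) hσ.le
  refine ⟨hhas, fun i => by simpa using hentry' i i,
    fun i j hij => by simpa [Matrix.one_apply_ne hij] using hentry' i j, ?_⟩
  have hdet := abs_det_sub_pow_le hD.le hσ.le (by linarith) hentry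
  rw [Fintype.card_fin] at hdet
  exact hdet.trans (mul_le_mul_of_nonneg_right (le_add_of_nonneg_left hD.le) (by positivity))
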